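/- Fix integers $k\ge 0$ and $n>k$ and a rational $c>0$. **Codings.** Pairs of natural numbers are coded by $\langle x,y\rangle=\frac12(x^2+2xy+y^2+3x+y)$, sequences by $\langle x_1,\dots,x_n\rangle=\langle\langle x_1,\dots,x_{n-1}\rangle,x_n\rangle$, and $\pi_i^n\langle x_1,\dots,x_n\rangle=x_i$. Integers are coded by $\zeta(i)=2i$ for $i\ge0$ and $\zeta(i)=-2i-1$ for $i<0$, and rational numbers by $\rho(0)=0$ and $\rho(\pm\prod_p p^{e_p})=\zeta(\pm\prod_p p^{\zeta(e_p)})$. The number $[a;b]=\langle\rho(a),\rho(b)\rangle$ codes the open interval $\iota[a;b]=\{x\in\mathbb R: a<x<b\}$. Let $\mathcal I_{10,c}$ be the basis of all decimal intervals, i.e. the sets $\iota[a;b]$ with $a=\frac{m-c}{10^d}$ and $b=\frac{m+1+c}{10^d}$, where $m\in\mathbb Z$ and $d\ge1$; $d$ is the number of digits of precision. The $n$-fold effective product of $(\mathcal I_{10,c},\iota)$ has as basis the products of $n$ decimal intervals and as coding $\nu\langle u_1,\dots,u_n\rangle=\iota(u_1)\times\dots\times\iota(u_n)$. **Oracles and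 representations.** For a basis $\mathcal B$ with coding $\nu$, a set $\mathcal L\subseteq\mathcal B$ is a local basis for $x$ if every $L\in\mathcal L$ contains $x$ and every $B\in\mathcal B$ with $x\in B$ includes some $L\in\mathcal L$. A nested oracle for $x$ is a function $\phi:\mathbb N\to\{u:\nu(u)\in\mathcal B\}$ such that $\nu(\phi(\mathbb N))$ is a local basis for $x$ and $\nu(\phi(m+1))\subseteq\nu(\phi(m))$ for all $m$. A set $R\subseteq\{u:\nu(u)\in\mathcal B\}$ is a basic representation of a set $A$ of points if, for every point $x$, $x\in A$ if and only if $x$ has a local basis included in $\nu(R)$. **Kreisel's criterion.** Programs $\kappa_1,\dots,\kappa_{n-k}$, computing partial recursive functionals of $k$ function arguments (oracles) and one number argument, *compute* $\psi:\mathbb R^k\to\mathbb R^{n-k}$ if, whenever $\phi_1,\dots,\phi_k$ are nested oracles for real numbers $x_1,\dots,x_k$ in $(\mathcal I_{10,c},\iota)$ and $1\le j\le n-k$, the value $\kappa_j(\phi_1,\dots,\phi_k,m)$ is defined for all $m\in\mathbb N$ and $\lambda m[\kappa_j(\phi_1,\dots,\phi_k,m)]$ is a nested oracle in $(\mathcal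 I_{10,c},\iota)$ for the $j$-th coordinate of $\psi(x_1,\dots,x_k)$. **The class $\mathcal K_{k,n,c}$.** For a real number $p$, let $o_p(l)$ be the code of the decimal interval with $m=\lfloor 10^{l+1}p\rfloor$ and $d=l+1$. For the code $u$ of a decimal interval with midpoint $p$ and $d$ digits of precision, let $\sigma_u(l)=o_p(l)$ for $l<d$, and let $\sigma_u(l)$ be undefined for $l\ge d$. Given programs $\kappa_1,\dots,\kappa_{n-k}$ that compute some function $\mathbb R^k\to\mathbb R^{n-k}$, let $R$ be the set of all $\langle u_1,\dots,u_n\rangle$ such that $u_1,\dots,u_k$ are codes of decimal intervals and such that for each $j\le n-k$ there is an $m$ with $u_{k+j}=\kappa_j(\sigma_{u_1},\dots,\sigma_{u_k},m)$ (a value is undefined if the program calls an oracle where it is undefined). Let $H=\{\pi_1^n,\dots,\pi_n^n\}$. The class $\mathcal K_{k,n,c}$ consists of all pairs $(R,H)$ obtained in this way. **Theorem.** (1) There is a computable map $G$ from programs to $(n-k)$-tuples of programs for functionals with the following property. Suppose $(R,H)\in\mathcal K_{k,n,c}$ and $\psi:\mathbb R^k\to\mathbb R^{n-k}$ is a function whose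 graph has basic representation $R$ in the $n$-fold effective product of $(\mathcal I_{10,c},\iota)$. Then $R$ is recursively enumerable, and for every program $e$ that halts exactly on the members of $R$, the programs $\kappa_1,\dots,\kappa_{n-k}$ in the tuple $G(e)$ compute $\psi$ in the above sense. (2) The same prediction is possible from a computable physical model. A computable physical model is a pair $(T,B)$, where $T\subseteq\mathbb N$ is recursive and $B$ is a set of total recursive functions. An isomorphism from $(S,A)$ to $(T,B)$ consists of bijections $f:S\to T$ and $g:A\to B$ with $\alpha(s)=g(\alpha)(f(s))$ for all $s\in S$ and $\alpha\in A$. For $(R,H)$ and $\psi$ as in (1), $(R,H)$ is isomorphic to a computable physical model. Moreover, there is a computable map $P$, independent of $(R,H)$ and $\psi$, that takes a program deciding $T$ and programs computing $\beta_1,\dots,\beta_n$, for any computable physical model $(T,\{\beta_1,\dots,\beta_n\})$ isomorphic to $(R,H)$ by an isomorphism that sends $\pi_i^n$ to $\beta_i$ for each $i$, to programs $\kappa_1,\dots,\kappa_{n-k}$ that compute $\psi$. -/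

import Mathlib

/-! ### Codings of sequences, integers and rational numbers -/

/-- Cantor's pairing function `⟨x, y⟩ = (x² + 2xy + y² + 3x + y) / 2`. -/
def cantorPair (x y : ℕ) : ℕ := (x ^ 2 + 2 * x * y + y ^ 2 + 3 * x + y) / 2

/-- The code `⟨x₁, …, xₙ⟩ = ⟨⟨x₁, …, xₙ₋₁⟩, xₙ⟩` of a sequence of length `n ≥ 1`, with `⟨x₁⟩ = x₁`
(the value for `n = 0` is irrelevant). -/
def tupleCode : (n : ℕ) → (Fin n → ℕ) → ℕ
  | 0, _ => 0
  | 1, x => x 0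
  | n + 2, x => cantorPair (tupleCode (n + 1) fun i => x i.castSucc) (x (Fin.last (n + 1)))

/-- The projection function `πᵢⁿ`, with `πᵢⁿ⟨x₁, …, xₙ⟩ = xᵢ` (see `projection_tupleCode`). -/
noncomputable def projection (n : ℕ) (i : Fin n) (r : ℕ) : ℕ := Function.invFun (tupleCode n) r i

theorem cantorPair_eq (x y : ℕ) :
    cantorPair x y = (x + y) * (x + y + 1) / 2 + x := by
  unfold cantorPair
  have : x ^ 2 + 2 * x * y + y ^ 2 + 3 * x + y = (x + y) * (x + y + 1) + x * 2 := by ring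
  rw [this, Nat.add_mul_div_right _ _ (by norm_num)]

theorem cantorPair_lt_of_add_lt {x y z w : ℕ} (h : x + y < z + w) :
    cantorPair x y < cantorPair z w := by
  rw [cantorPair_eq, cantorPair_eq]
  have h1 : (x + y + 1) * (x + y + 1 + 1) / 2 = (x + y) * (x + y + 1) / 2 + (x + y + 1) := by
    have : (x + y + 1) * (x + y + 1 + 1) = (x + y) * (x + y + 1) + (x + y + 1) * 2 := by ring
    rw [this, Nat.add_mul_div_right _ _ (by norm_num)]
  have h2 : (x + y + 1) * (x + y + 1 + 1) / 2 ≤ (z + w) * (z + w + 1) / 2 :=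
    Nat.div_le_div_right (Nat.mul_le_mul h (Nat.succ_le_succ h))
  omega

theorem cantorPair_inj {x y z w : ℕ} (h : cantorPair x y = cantorPair z w) : x = z ∧ y = w := by
  rcases lt_trichotomy (x + y) (z + w) with h' | h' | h'
  · exact absurd h (cantorPair_lt_of_add_lt h').ne
  · rw [cantorPair_eq, cantorPair_eq, h'] at h
    omega
  · exact absurd h (cantorPair_lt_of_add_lt h').ne'

theorem tupleCode_injective : ∀ n : ℕ, Function.Injective (tupleCode n)
  | 0 => fun _ _ _ => Subsingleton.elim _ _
  | 1 => fun x y h => by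
      funext i
      rw [Subsingleton.elim i 0]
      exact h
  | n + 2 => fun x y h => by
      obtain ⟨h1, h2⟩ := cantorPair_inj h
      have h3 := tupleCode_injective (n + 1) h1
      funext i
      refine Fin.lastCases h2 (fun i => ?_) i
      exact congrFun h3 i

theorem projection_tupleCode (n : ℕ) (i : Fin n) (x : Fin n → ℕ) :
    projection n i (tupleCode n x) = x i :=
  congrFun (Function.leftInverse_invFun (tupleCode_injective n) x) i

/-- The code `ζ(i)` of an integer. -/
def integerCode (i : ℤ) : ℕ := if i < 0 then (-2 * i - 1).toNat else (2 * i).toNat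

/-- The code `ρ(q)` of a rational number: if `q = ± 2 ^ e₁ * 3 ^ e₂ * 5 ^ e₃ * ⋯` then
`ρ(q) = ζ(± 2 ^ ζ(e₁) * 3 ^ ζ(e₂) * 5 ^ ζ(e₃) * ⋯)`, and `ρ(0) = 0`. -/
def rationalCode (q : ℚ) : ℕ :=
  integerCode (q.num.sign *
    ∏ p ∈ (q.num.natAbs * q.den).primeFactors, (p : ℤ) ^ integerCode (padicValRat p q))

/-- The code `⟨ρ(a), ρ(b)⟩` of the pair of endpoints of an interval. -/
def intervalCode (a b : ℚ) : ℕ := cantorPair (rationalCode a) (rationalCode b)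

/-! ### Coded bases, oracles and basic representations -/

/-- A pair `(ℬ, ν)`: a basis together with a coding of its elements by natural numbers. A number
`u` is the code of a basis element exactly if `ν u ∈ ℬ`. -/
structure CodedBasis (X : Type*) where
  basis : Set (Set X)
  coding : ℕ → Set X

namespace CodedBasis

variable {X : Type*}

/-- The domain of the coding. -/
def dom (T : CodedBasis X) : Set ℕ := {u | T.coding u ∈ T.basis}

/-- `L` is a local basis for the point `x`. -/
def IsLocalBasis (T : CodedBasis X) (x : X) (L : Set (Set X)) : Prop :=
  L ⊆ T.basis ∧ (∀ U ∈ L, x ∈ U) ∧ ∀ B ∈ T.basis, x ∈ B → ∃ U ∈ L, U ⊆ B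

/-- `φ` is an oracle for the point `x`. -/
def IsOracle (T : CodedBasis X) (φ : ℕ → ℕ) (x : X) : Prop :=
  (∀ m, φ m ∈ T.dom) ∧ T.IsLocalBasis x (T.coding '' Set.range φ)

/-- `φ` is a nested oracle for the point `x`. -/
def IsNestedOracle (T : CodedBasis X) (φ : ℕ → ℕ) (x : X) : Prop :=
  T.IsOracle φ x ∧ ∀ m, T.coding (φ (m + 1)) ⊆ T.coding (φ m)

/-- `R` is a basic representation of the set `A`. -/
def IsBasicRepresentation (T : CodedBasis X) (R : Set ℕ) (A : Set X) : Prop :=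
  R ⊆ T.dom ∧ ∀ x, x ∈ A ↔ ∃ L, T.IsLocalBasis x L ∧ L ⊆ T.coding '' R

/-- The effective product of `n` copies of `(ℬ, ν)`: the basis consists of the products
`B₁ × ⋯ × Bₙ` of basis elements, and `⟨a₁, …, aₙ⟩` is a code of `ν a₁ × ⋯ × ν aₙ`. -/
def power (T : CodedBasis X) (n : ℕ) : CodedBasis (Fin n → X) where
  basis := {B | ∃ b : Fin n → Set X, (∀ i, b i ∈ T.basis) ∧ B = Set.univ.pi b}
  coding r := {x | ∃ a : Fin n → ℕ, r = tupleCode n a ∧ ∀ i, x i ∈ T.coding (a i)}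

end CodedBasis

/-! ### Decimal intervals -/

/-- The coding `ι` of open intervals with rational endpoints. -/
def iota (u : ℕ) : Set ℝ := {x | ∃ a b : ℚ, u = intervalCode a b ∧ (a : ℝ) < x ∧ x < (b : ℝ)}

/-- The code of the decimal interval with endpoints `m / 10 ^ d - c / 10 ^ d` and
`(m + 1) / 10 ^ d + c / 10 ^ d`. -/
def decimalCode (c : ℚ) (m : ℤ) (d : ℕ) : ℕ :=
  intervalCode (m / 10 ^ d - c / 10 ^ d) ((m + 1) / 10 ^ d + c / 10 ^ d)

/-- The decimal intervals with accuracy factor `c`, with the coding `ι`. -/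
def decimalBasis (c : ℚ) : CodedBasis ℝ where
  basis := {B | ∃ (m : ℤ) (d : ℕ), 0 < d ∧ B = iota (decimalCode c m d)}
  coding := iota

/-- `u` is the code of a decimal interval with midpoint `p` and with `d` digits of precision. -/
def IsDecimalCode (c : ℚ) (u : ℕ) (p : ℝ) (d : ℕ) : Prop :=
  ∃ m : ℤ, 0 < d ∧ u = decimalCode c m d ∧ p = (m + 1 / 2) / 10 ^ d

/-- The standard decimal oracle `o_x`. -/
noncomputable def standardOracle (c : ℚ) (x : ℝ) (l : ℕ) : ℕ :=
  decimalCode c ⌊10 ^ (l + 1) * x⌋ (l + 1)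

/-- The finite part `σ` of the standard decimal oracle of `p`, defined for arguments below `d`. -/
noncomputable def truncatedOracle (c : ℚ) (p : ℝ) (d : ℕ) : ℕ →. ℕ :=
  fun l => ⟨l < d, fun _ => standardOracle c p l⟩

/-! ### Programs with oracles -/

/-- Programs for the partial recursive functionals of `k` function arguments and one number
argument. -/
inductive OracleCode (k : ℕ) : Type
  | zero : OracleCode k
  | succ : OracleCode k
  | left : OracleCode k
  | right : OracleCode k
  | oracle : Fin k → OracleCode k
  | pair : OracleCode k → OracleCode k → OracleCode k
  | comp : OracleCode k → OracleCode k → OracleCode k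
  | prec : OracleCode k → OracleCode k → OracleCode k
  | rfind : OracleCode k → OracleCode k

namespace OracleCode

variable {k : ℕ}

/-- `eval φ κ m` is the result `κ(φ₁, …, φₖ, m)` of running the program `κ` on `m` with the oracles
`φ₁, …, φₖ`. The oracles may be partial: the result is undefined if the program calls an oracle at
an argument where it is undefined. -/
def eval (φ : Fin k → ℕ →. ℕ) : OracleCode k → ℕ →. ℕ
  | zero => fun _ => Part.some 0
  | succ => fun n => Part.some (n + 1)
  | left => fun n => Part.some (Nat.unpair n).1
  | right => fun n => Part.some (Nat.unpair n).2
  | oracle i => φ i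
  | pair f g => fun n => Nat.pair <$> eval φ f n <*> eval φ g n
  | comp f g => fun n => eval φ g n >>= eval φ f
  | prec f g => fun p =>
      let (a, n) := Nat.unpair p
      n.rec (eval φ f a) fun y IH => do
        let i ← IH
        eval φ g (Nat.pair a (Nat.pair y i))
  | rfind f => fun a => Nat.rfind fun n => (fun m => decide (m = 0)) <$> eval φ f (Nat.pair a n)

/-- A numbering of the programs. -/
def toNat : OracleCode k → ℕ
  | zero => Nat.pair 0 0
  | succ => Nat.pair 1 0
  | left => Nat.pair 2 0
  | right => Nat.pair 3 0
  | oracle i => Nat.pair 4 i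
  | pair f g => Nat.pair 5 (Nat.pair f.toNat g.toNat)
  | comp f g => Nat.pair 6 (Nat.pair f.toNat g.toNat)
  | prec f g => Nat.pair 7 (Nat.pair f.toNat g.toNat)
  | rfind f => Nat.pair 8 f.toNat

theorem toNat_injective : Function.Injective (toNat (k := k)) := by
  intro f
  induction f with
  | zero | succ | left | right => intro g h; cases g <;> simp_all [toNat, Nat.pair_eq_pair]
  | oracle i =>
    intro g h
    cases g <;> simp_all [toNat, Nat.pair_eq_pair, Fin.ext_iff]
  | pair f g hf hg | comp f g hf hg | prec f g hf hg =>
    intro e h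
    cases e <;> simp [toNat, Nat.pair_eq_pair] at h ⊢
    exact ⟨hf h.1, hg h.2⟩
  | rfind f hf =>
    intro e h
    cases e <;> simp [toNat, Nat.pair_eq_pair] at h ⊢
    exact hf h

/-- The functions computed by programs with the oracles `φ` are the functions that are partial
recursive in `φ`. -/
theorem recursiveIn_iff (φ : Fin k → ℕ →. ℕ) (f : ℕ →. ℕ) :
    Nat.RecursiveIn (Set.range φ) f ↔ ∃ κ : OracleCode k, eval φ κ = f := by
  constructor
  · intro h
    induction h with
    | zero => exact ⟨zero, rfl⟩
    | succ => exact ⟨succ, rfl⟩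
    | left => exact ⟨left, rfl⟩
    | right => exact ⟨right, rfl⟩
    | oracle g hg => obtain ⟨i, rfl⟩ := hg; exact ⟨oracle i, rfl⟩
    | pair _ _ h1 h2 => obtain ⟨a, rfl⟩ := h1; obtain ⟨b, rfl⟩ := h2; exact ⟨pair a b, rfl⟩
    | comp _ _ h1 h2 => obtain ⟨a, rfl⟩ := h1; obtain ⟨b, rfl⟩ := h2; exact ⟨comp a b, rfl⟩
    | prec _ _ h1 h2 => obtain ⟨a, rfl⟩ := h1; obtain ⟨b, rfl⟩ := h2; exact ⟨prec a b, rfl⟩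
    | rfind _ h1 => obtain ⟨a, rfl⟩ := h1; exact ⟨rfind a, rfl⟩
  · rintro ⟨κ, rfl⟩
    induction κ with
    | zero => exact .zero
    | succ => exact .succ
    | left => exact .left
    | right => exact .right
    | oracle i => exact .oracle _ ⟨i, rfl⟩
    | pair f g hf hg => exact .pair hf hg
    | comp f g hf hg => exact .comp hf hg
    | prec f g hf hg => exact .prec hf hg
    | rfind f hf => exact .rfind hf

end OracleCode

/-! ### Kreisel's criterion and the representations constructed from it -/

/-- The programs `κ₁, …, κ_l` compute `ψ : ℝᵏ → ℝˡ` on nested decimal oracles: if `φ₁, …, φₖ` are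
nested oracles for `x₁, …, xₖ`, then, for each `j`, `κⱼ(φ₁, …, φₖ, m)` is defined for all `m` and is,
as a function of `m`, a nested oracle for the `j`-th coordinate of `ψ(x₁, …, xₖ)`. -/
def ComputesOnNestedOracles {k l : ℕ} (c : ℚ) (ψ : (Fin k → ℝ) → (Fin l → ℝ))
    (κ : Fin l → OracleCode k) : Prop :=
  ∀ (x : Fin k → ℝ) (φ : Fin k → ℕ → ℕ),
    (∀ i, (decimalBasis c).IsNestedOracle (φ i) (x i)) →
    ∀ j, ∃ f : ℕ → ℕ,
      (∀ m, f m ∈ (κ j).eval (fun i => (φ i : ℕ →. ℕ)) m) ∧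
      (decimalBasis c).IsNestedOracle f (ψ x j)

/-- The set `R` constructed from the programs `κ₁, …, κ_l`: it consists of all
`⟨u₁, …, uₖ, uₖ₊₁, …, uₖ₊ₗ⟩` such that each `uᵢ` with `i ≤ k` is the code of a decimal interval and
each `uₖ₊ⱼ` is a value `κⱼ(σ_{u₁}, …, σ_{uₖ}, m)` for some `m`. -/
def constructedStates {k l : ℕ} (c : ℚ) (κ : Fin l → OracleCode k) : Set ℕ :=
  {r | ∃ u : Fin (k + l) → ℕ, r = tupleCode (k + l) u ∧
    ∃ (p : Fin k → ℝ) (d : Fin k → ℕ),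
      (∀ i, IsDecimalCode c (u (Fin.castAdd l i)) (p i) (d i)) ∧
      ∀ j, ∃ m, u (Fin.natAdd k j) ∈ (κ j).eval (fun i => truncatedOracle c (p i) (d i)) m}

/-- The collection `𝒦_{k,n,c}`, for `n = k + l`, of all pairs `(R, H)` constructed from functions
`ψ : ℝᵏ → ℝˡ` that satisfy Kreisel's criterion; `H` is the set of projection functions. -/
def kreiselRepresentations (k l : ℕ) (c : ℚ) : Set (Set ℕ × Set (ℕ → ℕ)) :=
  {M | ∃ (ψ : (Fin k → ℝ) → (Fin l → ℝ)) (κ : Fin l → OracleCode k),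
    ComputesOnNestedOracles c ψ κ ∧
    M = (constructedStates c κ, Set.range (projection (k + l)))}

/-- The graph of `ψ : ℝᵏ → ℝˡ`, as a subset of `ℝᵏ⁺ˡ`. -/
def graphSet {k l : ℕ} (ψ : (Fin k → ℝ) → (Fin l → ℝ)) : Set (Fin (k + l) → ℝ) :=
  {y | ψ (fun i => y (Fin.castAdd l i)) = fun j => y (Fin.natAdd k j)}

/-! ### Computable physical models -/

/-- `(T, B)` is a computable physical model: `T` is a recursive set and the members of `B` are total
recursive functions. -/
def IsComputableModel (T : Set ℕ) (B : Set (ℕ → ℕ)) : Prop :=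
  ComputablePred (fun s => s ∈ T) ∧ ∀ β ∈ B, Computable β

/-- `(f, g)` is an isomorphism from the physical model `(S, A)` to the physical model `(T, B)`. -/
def IsModelIso (S : Set ℕ) (A : Set (ℕ → ℕ)) (T : Set ℕ) (B : Set (ℕ → ℕ))
    (f : ℕ → ℕ) (g : (ℕ → ℕ) → (ℕ → ℕ)) : Prop :=
  Set.BijOn f S T ∧ Set.BijOn g A B ∧ ∀ s ∈ S, ∀ α ∈ A, α s = g α (f s)

/-- The program `t` decides membership in `T`. -/
def Decides (t : Nat.Partrec.Code) (T : Set ℕ) : Prop :=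
  ∀ s, (s ∈ T → t.eval s = Part.some 1) ∧ (s ∉ T → t.eval s = Part.some 0)

/-- The program `e` semi-decides membership in `R`: it halts exactly on the members of `R`. -/
def SemiDecides (e : Nat.Partrec.Code) (R : Set ℕ) : Prop :=
  ∀ r, (e.eval r).Dom ↔ r ∈ R

/-! A tuple in `R` is sound for the function computed by the programs that built `R`. The finite
oracle of an interval `u` runs through ever smaller decimal intervals and ends with `u` itself, so
for every point `x` of `u` it extends to a nested oracle for `x` (`exists_nestedOracle_extending`).
A halting computation that uses the finite oracles is unchanged by this extension (`eval_mono`), so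
its result is an interval containing the true value (`mem_iota_of_mem_constructedStates`). If `R`
also represents the graph of `ψ`, then `R` has arbitrarily small boxes around each point of that
graph, and soundness forces `ψ` to be the function computed by the programs
(`graph_unique_of_isBasicRepresentation`). Soundness and small boxes together form `IsPredictive`,
and the prediction uses nothing else about `R`.

To predict from a program for `R` and nested oracles for `x`, search for a tuple in `R` whose input
intervals include oracle values, and whose `j`-th output interval has more than `m` digits and lies
inside the previous output. Soundness makes every hit contain `ψ x j`; small boxes and nestedness
guarantee a hit. Iterating gives a nested oracle (`exists_predictor`). The program for `R` enters
only as a number, so fixing that argument (`curry`) is a computable map.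

For physical models, `R` is the set of tuples `⟨β₁(s), …, βₙ(s)⟩` with `s ∈ T`, so programs for a
model yield a program for `R` (`exists_semiDecides_of_model`), and the first predictor applies.
Conversely, an enumerable `R` becomes recursive once each member carries its first halting time
(`exists_computableModel`).

The searches need the codes and the inclusion of intervals to be primitive recursive. Intervals are
therefore handled as triples of natural numbers, and the prime factorization in `ρ` is replaced by a
formula with gcd and radical. -/

/-! ### Injectivity of the codings -/

theorem integerCode_injective : Function.Injective integerCode := by
  intro i j h
  unfold integerCode at h
  split_ifs at h <;> omega

theorem integerCode_natCast (n : ℕ) : integerCode n = 2 * n := by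
  unfold integerCode
  split_ifs <;> omega

theorem integerCode_neg_natCast (n : ℕ) : integerCode (-n) = 2 * n - 1 := by
  unfold integerCode
  split_ifs <;> omega

/-- The product `∏ p ^ (2 * vₚ(n) - 1)` over the prime factors of `n`. -/
def oddPowers (n : ℕ) : ℕ := ∏ p ∈ n.primeFactors, p ^ (2 * n.factorization p - 1)

theorem oddPowers_mul_radical {n : ℕ} (hn : n ≠ 0) :
    oddPowers n * ∏ p ∈ n.primeFactors, p = n ^ 2 := by
  conv_rhs => rw [← Nat.prod_factorization_pow_eq_self hn]
  rw [Finsupp.prod, Nat.support_factorization, oddPowers, ← Finset.prod_mul_distrib,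
    ← Finset.prod_pow]
  refine Finset.prod_congr rfl fun p hp => ?_
  have h1 : 0 < n.factorization p :=
    (Nat.prime_of_mem_primeFactors hp).factorization_pos_of_dvd hn (Nat.dvd_of_mem_primeFactors hp)
  rw [← pow_succ, ← pow_mul]
  congr 1
  omega

theorem oddPowers_eq_div {n : ℕ} (hn : n ≠ 0) :
    oddPowers n = n ^ 2 / ∏ p ∈ n.primeFactors, p := by
  rw [← oddPowers_mul_radical hn, Nat.mul_div_cancel]
  exact Finset.prod_pos fun p hp => (Nat.prime_of_mem_primeFactors hp).pos

theorem factorization_oddPowers {n : ℕ} (p : ℕ) :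
    (oddPowers n).factorization p = 2 * n.factorization p - 1 := by
  have : oddPowers n = Finsupp.prod
      (n.factorization.mapRange (fun v => 2 * v - 1) rfl) (fun p e => p ^ e) := by
    rw [oddPowers, Finsupp.prod_of_support_subset _ (s := n.primeFactors)]
    · rfl
    · intro q hq
      rw [← Nat.support_factorization]
      exact Finsupp.support_mapRange hq
    · simp
  rw [this, Nat.prod_pow_factorization_eq_self]
  · rfl
  · intro q hq
    exact Nat.prime_of_mem_primeFactors (n := n)
      (by rw [← Nat.support_factorization]; exact Finsupp.support_mapRange hq)

theorem oddPowers_ne_zero (n : ℕ) : oddPowers n ≠ 0 :=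
  Finset.prod_ne_zero_iff.2 fun _ hp => pow_ne_zero _ (Nat.prime_of_mem_primeFactors hp).ne_zero

/-- Numerator and denominator are coprime, so the product splits: an exponent `v > 0` becomes `2v`,
which squares the numerator, and an exponent `-v < 0` becomes `2v - 1`. -/
theorem rationalCode_eq (q : ℚ) :
    rationalCode q = integerCode (q.num.sign * ((q.num.natAbs ^ 2 * oddPowers q.den : ℕ) : ℤ)) := by
  unfold rationalCode
  by_cases h0 : q.num = 0
  · simp [h0]
  congr 2
  have ha : q.num.natAbs ≠ 0 := Int.natAbs_ne_zero.2 h0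
  have hcop := q.reduced
  rw [hcop.primeFactors_mul, Finset.prod_union hcop.disjoint_primeFactors, Nat.cast_mul]
  congr 1
  · conv_rhs => rw [← Nat.prod_factorization_pow_eq_self ha]
    rw [Finsupp.prod, Nat.support_factorization]
    push_cast
    rw [← Finset.prod_pow]
    refine Finset.prod_congr rfl fun p hp => ?_
    have hp' := Nat.prime_of_mem_primeFactors hp
    have : padicValRat p q = (q.num.natAbs.factorization p : ℕ) := by
      have hnd : ¬ p ∣ q.den := fun hd =>
        hp'.one_lt.ne' (Nat.eq_one_of_dvd_coprimes hcop (Nat.dvd_of_mem_primeFactors hp) hd)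
      rw [padicValRat, padicValNat.eq_zero_of_not_dvd hnd, Nat.factorization_def _ hp']
      simp [padicValInt]
    rw [this, integerCode_natCast, ← pow_mul, mul_comm]
  · rw [oddPowers]
    push_cast
    refine Finset.prod_congr rfl fun p hp => ?_
    have hp' := Nat.prime_of_mem_primeFactors hp
    have : padicValRat p q = -(q.den.factorization p : ℕ) := by
      have hnd : ¬ p ∣ q.num.natAbs := fun hd =>
        hp'.one_lt.ne' (Nat.eq_one_of_dvd_coprimes hcop hd (Nat.dvd_of_mem_primeFactors hp))
      rw [padicValRat, padicValInt, padicValNat.eq_zero_of_not_dvd hnd,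
        Nat.factorization_def _ hp']
      simp
    rw [this, integerCode_neg_natCast]

/-- The sign survives the coding, and the parity of the exponent of a prime tells whether that prime
comes from the numerator (even) or from the denominator (odd). -/
theorem rationalCode_injective : Function.Injective rationalCode := by
  intro q r h
  rw [rationalCode_eq, rationalCode_eq] at h
  have h := integerCode_injective h
  have hsign : q.num.sign = r.num.sign := by
    have pos : ∀ s : ℚ, s.num ≠ 0 → ((0 : ℤ) < (s.num.natAbs ^ 2 * oddPowers s.den : ℕ)) := by
      intro s hs
      have := Nat.pos_of_ne_zero (oddPowers_ne_zero s.den)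
      have := Int.natAbs_pos.2 hs
      exact_mod_cast (by positivity)
    have key : ∀ s : ℚ, (s.num.sign * ((s.num.natAbs ^ 2 * oddPowers s.den : ℕ) : ℤ)).sign
        = s.num.sign := by
      intro s
      rw [Int.sign_mul]
      by_cases hs : s.num = 0
      · simp [hs]
      · rw [Int.sign_eq_one_of_pos (pos s hs)]; simp
    rw [← key q, h, key r]
  by_cases h0 : q.num = 0
  · have h1 : r.num = 0 := by rw [h0] at hsign; simpa using hsign.symm
    rw [Rat.num_eq_zero.1 h0, Rat.num_eq_zero.1 h1]
  have h1 : r.num ≠ 0 := fun hr => by rw [hr] at hsign; simp at hsign; exact h0 (by simp [hsign])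
  rw [hsign] at h
  have hN := Int.ofNat_injective (mul_left_cancel₀ (by simpa using h1) h)
  have hq := Int.natAbs_ne_zero.2 h0
  have hr := Int.natAbs_ne_zero.2 h1
  have hfac : ∀ p, q.num.natAbs.factorization p = r.num.natAbs.factorization p ∧
      q.den.factorization p = r.den.factorization p := by
    intro p
    have h2 := congrArg (fun n => n.factorization p) hN
    rw [Nat.factorization_mul (pow_ne_zero _ hq) (oddPowers_ne_zero _),
      Nat.factorization_mul (pow_ne_zero _ hr) (oddPowers_ne_zero _)] at h2
    simp only [Nat.factorization_pow, Finsupp.add_apply, Finsupp.smul_apply, smul_eq_mul,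
      factorization_oddPowers] at h2
    -- With at most one exponent nonzero on each side, the parity argument becomes linear
    -- arithmetic.
    have cop : ∀ s : ℚ, s.num.natAbs.factorization p = 0 ∨ s.den.factorization p = 0 := by
      intro s
      by_contra! hc
      have hp := Nat.prime_of_mem_primeFactors
        (Nat.support_factorization _ ▸ Finsupp.mem_support_iff.2 hc.1)
      exact hp.one_lt.ne' (Nat.eq_one_of_dvd_coprimes s.reduced
        (Nat.dvd_of_factorization_pos hc.1) (Nat.dvd_of_factorization_pos hc.2))
    have c1 := cop q
    have c2 := cop r
    omega
  have e1 := Nat.eq_of_factorization_eq hq hr fun p => (hfac p).1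
  have e2 := Nat.eq_of_factorization_eq q.den_nz r.den_nz fun p => (hfac p).2
  refine Rat.ext ?_ e2
  rw [← Int.sign_mul_natAbs q.num, ← Int.sign_mul_natAbs r.num, hsign, e1]

theorem iota_intervalCode (a b : ℚ) : iota (intervalCode a b) = Set.Ioo (a : ℝ) b := by
  ext x
  constructor
  · rintro ⟨a', b', h, h1, h2⟩
    obtain ⟨ha, hb⟩ := cantorPair_inj h
    rw [rationalCode_injective ha, rationalCode_injective hb]
    exact ⟨h1, h2⟩
  · rintro ⟨h1, h2⟩
    exact ⟨a, b, rfl, h1, h2⟩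

/-! ### Primitive recursive codes of rational numbers and tuples -/

theorem Primrec.nat_pow : Primrec₂ ((· ^ ·) : ℕ → ℕ → ℕ) :=
  Primrec₂.unpaired'.1 Nat.Primrec.pow

theorem Primrec.nat_dvd : PrimrecRel ((· ∣ ·) : ℕ → ℕ → Prop) :=
  (Primrec.eq.comp (Primrec.nat_mod.comp Primrec.snd Primrec.fst) (Primrec.const 0)).of_eq
    fun _ => (Nat.dvd_iff_mod_eq_zero).symm

theorem gcd_eq_findGreatest (a : ℕ) {b : ℕ} (hb : b ≠ 0) :
    Nat.gcd a b = Nat.findGreatest (fun d => d ∣ a ∧ d ∣ b) b := by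
  symm
  rw [Nat.findGreatest_eq_iff]
  refine ⟨Nat.gcd_le_right _ (Nat.pos_of_ne_zero hb),
    fun _ => ⟨Nat.gcd_dvd_left _ _, Nat.gcd_dvd_right _ _⟩, fun n hn _ h => ?_⟩
  have := Nat.le_of_dvd (Nat.gcd_pos_of_pos_right _ (Nat.pos_of_ne_zero hb)) (Nat.dvd_gcd h.1 h.2)
  omega

theorem prod_primeFactors_le_of_dvd_pow {n r : ℕ} (k : ℕ) (hr : r ≠ 0) (h : n ∣ r ^ k) :
    ∏ p ∈ n.primeFactors, p ≤ r := by
  refine (Finset.prod_le_prod_of_subset_of_one_le' (t := r.primeFactors) ?_ ?_).trans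
    (Nat.le_of_dvd (Nat.pos_of_ne_zero hr) (Nat.prod_primeFactors_dvd r))
  · intro p hp
    have hp' := Nat.prime_of_mem_primeFactors hp
    exact Nat.mem_primeFactors.2
      ⟨hp', hp'.dvd_of_dvd_pow ((Nat.dvd_of_mem_primeFactors hp).trans h), hr⟩
  · intro p hp _
    exact (Nat.prime_of_mem_primeFactors hp).one_le

theorem dvd_prod_primeFactors_pow {n : ℕ} (hn : n ≠ 0) :
    n ∣ (∏ p ∈ n.primeFactors, p) ^ n := by
  conv_lhs => rw [← Nat.prod_factorization_pow_eq_self hn]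
  rw [Finsupp.prod, Nat.support_factorization, ← Finset.prod_pow]
  exact Finset.prod_dvd_prod_of_dvd _ _ fun p _ => pow_dvd_pow _ (Nat.factorization_lt p hn).le

/-- The radical is the least `r > 0` with `n ∣ r ^ n`. Writing `r = n - s` turns this minimum into a
bounded maximum, which is primitive recursive without any factorization. -/
theorem prod_primeFactors_eq_sub_findGreatest {n : ℕ} (hn : n ≠ 0) :
    ∏ p ∈ n.primeFactors, p = n - Nat.findGreatest (fun s => n ∣ (n - s) ^ n) (n - 1) := by
  have hpos : 0 < ∏ p ∈ n.primeFactors, p :=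
    Finset.prod_pos fun p hp => (Nat.prime_of_mem_primeFactors hp).pos
  have hle := prod_primeFactors_le_of_dvd_pow (n := n) 1 hn (by simp)
  have : Nat.findGreatest (fun s => n ∣ (n - s) ^ n) (n - 1)
      = n - ∏ p ∈ n.primeFactors, p := by
    rw [Nat.findGreatest_eq_iff]
    refine ⟨by omega, fun _ => ?_, fun s hs hs' h => ?_⟩
    · rw [Nat.sub_sub_self hle]
      exact dvd_prod_primeFactors_pow hn
    · have := prod_primeFactors_le_of_dvd_pow n (by omega) h
      omega
  omega

/-- A primitive recursive formula for the code of the rational number `(x - y) / D`. -/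
def fractionCode (x y D : ℕ) : ℕ :=
  let n := (x - y) + (y - x)
  let g := Nat.findGreatest (fun d => d ∣ n ∧ d ∣ D) D
  let b := D / g
  let N := (n / g) ^ 2 * (b ^ 2 / (b - Nat.findGreatest (fun s => b ∣ (b - s) ^ b) (b - 1)))
  if x < y then 2 * N - 1 else 2 * N

theorem rationalCode_div (x y : ℕ) {D : ℕ} (hD : D ≠ 0) :
    rationalCode (((x : ℚ) - y) / D) = fractionCode x y D := by
  unfold fractionCode
  simp only []
  rw [← gcd_eq_findGreatest _ hD]
  set n := (x - y) + (y - x) with hn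
  set g := n.gcd D with hg
  have hgpos : 0 < g := Nat.gcd_pos_of_pos_right _ (Nat.pos_of_ne_zero hD)
  have hbpos : 0 < D / g := Nat.div_pos (Nat.gcd_le_right _ (Nat.pos_of_ne_zero hD)) hgpos
  rw [← prod_primeFactors_eq_sub_findGreatest hbpos.ne', ← oddPowers_eq_div hbpos.ne']
  have hcop : Nat.Coprime (n / g) (D / g) := Nat.coprime_div_gcd_div_gcd hgpos
  obtain ⟨e, he⟩ : g ∣ n := Nat.gcd_dvd_left _ _
  obtain ⟨b, hb⟩ : g ∣ D := Nat.gcd_dvd_right _ _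
  have he' : n / g = e := by rw [he, Nat.mul_div_cancel_left _ hgpos]
  have hb' : D / g = b := by rw [hb, Nat.mul_div_cancel_left _ hgpos]
  rw [hb'] at hbpos
  rw [he', hb'] at hcop ⊢
  have hD' : (D : ℚ) = g * b := by rw [hb]; push_cast; rfl
  have hg0 : (g : ℚ) ≠ 0 := by positivity
  have hb0 : (b : ℚ) ≠ 0 := by positivity
  have hn' : (n : ℚ) = g * e := by rw [he]; push_cast; rfl
  split_ifs with hxy
  · have h1 : ((x : ℚ) - y) / D = ((-e : ℤ) : ℚ) / ((b : ℤ) : ℚ) := by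
      have : (x : ℚ) - y = -n := by
        have : (x : ℚ) + n = y := by exact_mod_cast (by omega : x + n = y)
        linarith
      rw [this, hD', hn']
      push_cast
      field_simp
    have hc : Nat.Coprime (-e : ℤ).natAbs (b : ℤ).natAbs := by simpa using hcop
    have e1 := Rat.num_div_eq_of_coprime (by exact_mod_cast hbpos) hc
    have e2 := Rat.den_div_eq_of_coprime (by exact_mod_cast hbpos) hc
    rw [h1, rationalCode_eq, e1, show (((-e : ℤ) : ℚ) / ((b : ℤ) : ℚ)).den = b by exact_mod_cast e2]
    have he0 : 0 < e := by
      rcases Nat.eq_zero_or_pos e with h | h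
      · simp [h] at he; omega
      · exact h
    rw [Int.sign_neg, Int.sign_eq_one_of_pos (by exact_mod_cast he0), neg_one_mul,
      integerCode_neg_natCast]
    simp
  · have h1 : ((x : ℚ) - y) / D = ((e : ℤ) : ℚ) / ((b : ℤ) : ℚ) := by
      have : (x : ℚ) - y = n := by
        have : (x : ℚ) = y + n := by exact_mod_cast (by omega : x = y + n)
        linarith
      rw [this, hD', hn']
      push_cast
      field_simp
    have hc : Nat.Coprime (e : ℤ).natAbs (b : ℤ).natAbs := by simpa using hcop
    have e1 := Rat.num_div_eq_of_coprime (by exact_mod_cast hbpos) hc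
    have e2 := Rat.den_div_eq_of_coprime (by exact_mod_cast hbpos) hc
    rw [h1, rationalCode_eq, e1, show (((e : ℤ) : ℚ) / ((b : ℤ) : ℚ)).den = b by exact_mod_cast e2]
    rcases Nat.eq_zero_or_pos e with h | h
    · simp [h, integerCode]
    · rw [Int.sign_eq_one_of_pos (by exact_mod_cast h), one_mul, integerCode_natCast]
      simp

theorem primrec_fractionCode :
    Primrec fun p : ℕ × ℕ × ℕ => fractionCode p.1 p.2.1 p.2.2 := by
  have hx : Primrec fun p : ℕ × ℕ × ℕ => p.1 := Primrec.fst
  have hy : Primrec fun p : ℕ × ℕ × ℕ => p.2.1 := Primrec.fst.comp Primrec.snd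
  have hD : Primrec fun p : ℕ × ℕ × ℕ => p.2.2 := Primrec.snd.comp Primrec.snd
  have hn : Primrec fun p : ℕ × ℕ × ℕ => (p.1 - p.2.1) + (p.2.1 - p.1) :=
    Primrec.nat_add.comp (Primrec.nat_sub.comp hx hy) (Primrec.nat_sub.comp hy hx)
  have hg : Primrec fun p : ℕ × ℕ × ℕ => Nat.findGreatest
      (fun d => d ∣ (p.1 - p.2.1) + (p.2.1 - p.1) ∧ d ∣ p.2.2) p.2.2 :=
    Primrec.nat_findGreatest hD
      ((Primrec.nat_dvd.comp Primrec.snd (hn.comp Primrec.fst)).and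
        (Primrec.nat_dvd.comp Primrec.snd (hD.comp Primrec.fst)))
  have hb := Primrec.nat_div.comp hD hg
  have hr : Primrec fun b : ℕ => b - Nat.findGreatest (fun s => b ∣ (b - s) ^ b) (b - 1) :=
    Primrec.nat_sub.comp Primrec.id (Primrec.nat_findGreatest
      (Primrec.nat_sub.comp Primrec.id (Primrec.const 1))
      (Primrec.nat_dvd.comp Primrec.fst (Primrec.nat_pow.comp
        (Primrec.nat_sub.comp Primrec.fst Primrec.snd) Primrec.fst)))
  have hN := Primrec.nat_mul.comp
    (Primrec.nat_pow.comp (Primrec.nat_div.comp hn hg) (Primrec.const 2))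
    (Primrec.nat_div.comp (Primrec.nat_pow.comp hb (Primrec.const 2)) (hr.comp hb))
  have h2 := Primrec.nat_mul.comp (Primrec.const 2) hN
  exact Primrec.ite (Primrec.nat_lt.comp hx hy) (Primrec.nat_sub.comp h2 (Primrec.const 1)) h2

theorem primrec_cantorPair : Primrec₂ cantorPair := by
  have hx : Primrec fun p : ℕ × ℕ => p.1 := Primrec.fst
  have hy : Primrec fun p : ℕ × ℕ => p.2 := Primrec.snd
  have hs := Primrec.nat_add.comp hx hy
  exact (Primrec.nat_add.comp (Primrec.nat_div.comp (Primrec.nat_mul.comp hs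
    (Primrec.succ.comp hs)) (Primrec.const 2)) hx).of_eq fun p => (cantorPair_eq p.1 p.2).symm

/-- The code of a nonempty list of natural numbers. -/
def listTupleCode (L : List ℕ) : ℕ := L.tail.foldl cantorPair L.headI

theorem primrec_listTupleCode : Primrec listTupleCode :=
  Primrec.list_foldl Primrec.list_tail Primrec.list_headI
    (primrec_cantorPair.comp (Primrec.fst.comp Primrec.snd) (Primrec.snd.comp Primrec.snd)).to₂

theorem listTupleCode_ofFn : ∀ (n : ℕ) (x : Fin n → ℕ), listTupleCode (List.ofFn x) = tupleCode n x
  | 0, _ => by simp [listTupleCode, tupleCode]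
  | 1, x => by simp [listTupleCode, tupleCode]
  | n + 2, x => by
      rw [tupleCode, ← listTupleCode_ofFn (n + 1), List.ofFn_succ', listTupleCode, listTupleCode,
        List.concat_eq_append, List.tail_append_of_ne_nil (by simp), List.foldl_append]
      simp

/-! ### Decimal intervals as triples of natural numbers -/

/-- The code of the decimal interval that is determined by `m = a - b` and `d`, for a triple
`(a, b, d)` of natural numbers. -/
def tripleCode (c : ℚ) (z : ℕ × ℕ × ℕ) : ℕ := decimalCode c ((z.1 : ℤ) - z.2.1) z.2.2

/-- The lower endpoint of the decimal interval of a triple. -/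
def tripleLower (c : ℚ) (z : ℕ × ℕ × ℕ) : ℚ := ((z.1 : ℚ) - z.2.1 - c) / 10 ^ z.2.2

/-- The upper endpoint of the decimal interval of a triple. -/
def tripleUpper (c : ℚ) (z : ℕ × ℕ × ℕ) : ℚ := ((z.1 : ℚ) - z.2.1 + 1 + c) / 10 ^ z.2.2

theorem iota_decimalCode (c : ℚ) (m : ℤ) (d : ℕ) : iota (decimalCode c m d) =
    Set.Ioo (((m - c) / 10 ^ d : ℝ)) (((m + 1 + c) / 10 ^ d : ℝ)) := by
  rw [decimalCode, iota_intervalCode]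
  push_cast
  rw [sub_div, add_div _ (c : ℝ)]

theorem iota_tripleCode (c : ℚ) (z : ℕ × ℕ × ℕ) :
    iota (tripleCode c z) = Set.Ioo (tripleLower c z : ℝ) (tripleUpper c z) := by
  rw [tripleCode, iota_decimalCode, tripleLower, tripleUpper]
  push_cast
  rfl

theorem exists_tripleCode_eq (c : ℚ) (m : ℤ) (d : ℕ) :
    ∃ z : ℕ × ℕ × ℕ, z.2.2 = d ∧ tripleCode c z = decimalCode c m d := by
  refine ⟨(m.toNat, (-m).toNat, d), rfl, ?_⟩
  rw [tripleCode, Int.toNat_sub_toNat_neg]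

theorem tripleUpper_sub_tripleLower (c : ℚ) (z : ℕ × ℕ × ℕ) :
    tripleUpper c z - tripleLower c z = (1 + 2 * c) / 10 ^ z.2.2 := by
  rw [tripleLower, tripleUpper]
  ring

theorem tripleLower_lt_tripleUpper {c : ℚ} (hc : 0 < c) (z : ℕ × ℕ × ℕ) :
    tripleLower c z < tripleUpper c z := by
  rw [← sub_pos, tripleUpper_sub_tripleLower]
  positivity

theorem primrec_tripleCode {c : ℚ} (hc : 0 < c) : Primrec (tripleCode c) := by
  obtain ⟨P, hP⟩ : ∃ P : ℕ, c.num = P := ⟨c.num.toNat, by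
    rw [Int.toNat_of_nonneg (Rat.num_nonneg.2 hc.le)]⟩
  have hcPQ : c = P / c.den := by
    conv_lhs => rw [← Rat.num_div_den c, hP]
    simp
  have hQ0 := c.den_nz
  generalize c.den = Q at hcPQ hQ0
  have ha : Primrec fun z : ℕ × ℕ × ℕ => z.1 := Primrec.fst
  have hb : Primrec fun z : ℕ × ℕ × ℕ => z.2.1 := Primrec.fst.comp Primrec.snd
  have hd : Primrec fun z : ℕ × ℕ × ℕ => z.2.2 := Primrec.snd.comp Primrec.snd
  have hD : Primrec fun z : ℕ × ℕ × ℕ => Q * 10 ^ z.2.2 :=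
    Primrec.nat_mul.comp (Primrec.const Q) (Primrec.nat_pow.comp (Primrec.const 10) hd)
  have haQ := Primrec.nat_mul.comp ha (Primrec.const Q)
  have hbQ := Primrec.nat_mul.comp hb (Primrec.const Q)
  refine (primrec_cantorPair.comp
    (primrec_fractionCode.comp (haQ.pair
      ((Primrec.nat_add.comp hbQ (Primrec.const P)).pair hD)))
    (primrec_fractionCode.comp ((Primrec.nat_add.comp haQ (Primrec.const (Q + P))).pair
      (hbQ.pair hD)))).of_eq fun z => ?_
  have hz : Q * 10 ^ z.2.2 ≠ 0 := by positivity
  rw [tripleCode, decimalCode, intervalCode, ← rationalCode_div _ _ hz, ← rationalCode_div _ _ hz]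
  have hQ : (Q : ℚ) ≠ 0 := by exact_mod_cast hQ0
  congr 2
  · rw [hcPQ]
    push_cast
    field_simp
    ring
  · rw [hcPQ]
    push_cast
    field_simp
    ring

/-- The decimal interval of `z` is included in that of `w`. -/
def TripleLE (c : ℚ) (z w : ℕ × ℕ × ℕ) : Prop :=
  tripleLower c w ≤ tripleLower c z ∧ tripleUpper c z ≤ tripleUpper c w

theorem tripleLE_iff {c : ℚ} (hc : 0 < c) (z w : ℕ × ℕ × ℕ) :
    TripleLE c z w ↔ iota (tripleCode c z) ⊆ iota (tripleCode c w) := by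
  rw [iota_tripleCode, iota_tripleCode, Set.Ioo_subset_Ioo_iff
    (by exact_mod_cast tripleLower_lt_tripleUpper hc z), TripleLE]
  norm_cast

theorem primrecRel_tripleLE {c : ℚ} (hc : 0 < c) : PrimrecRel (TripleLE c) := by
  obtain ⟨P, hP⟩ : ∃ P : ℕ, c.num = P := ⟨c.num.toNat, by
    rw [Int.toNat_of_nonneg (Rat.num_nonneg.2 hc.le)]⟩
  have hcPQ : c = P / c.den := by
    conv_lhs => rw [← Rat.num_div_den c, hP]
    simp
  have hQ0 := c.den_nz
  generalize c.den = Q at hcPQ hQ0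
  have ha : Primrec fun z : ℕ × ℕ × ℕ => z.1 := Primrec.fst
  have hb : Primrec fun z : ℕ × ℕ × ℕ => z.2.1 := Primrec.fst.comp Primrec.snd
  have hD : Primrec fun z : ℕ × ℕ × ℕ => 10 ^ z.2.2 :=
    Primrec.nat_pow.comp (Primrec.const 10) (Primrec.snd.comp Primrec.snd)
  have haQ := Primrec.nat_mul.comp ha (Primrec.const Q)
  have hbQ := Primrec.nat_mul.comp hb (Primrec.const Q)
  have hbP := Primrec.nat_add.comp hbQ (Primrec.const P)
  have haP := Primrec.nat_add.comp haQ (Primrec.const (Q + P))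
  have h1 : Primrec fun p : (ℕ × ℕ × ℕ) × (ℕ × ℕ × ℕ) =>
      (p.2.1 * Q) * 10 ^ p.1.2.2 + (p.1.2.1 * Q + P) * 10 ^ p.2.2.2 :=
    Primrec.nat_add.comp
      (Primrec.nat_mul.comp (haQ.comp Primrec.snd) (hD.comp Primrec.fst))
      (Primrec.nat_mul.comp (hbP.comp Primrec.fst) (hD.comp Primrec.snd))
  have h2 : Primrec fun p : (ℕ × ℕ × ℕ) × (ℕ × ℕ × ℕ) =>
      (p.1.1 * Q) * 10 ^ p.2.2.2 + (p.2.2.1 * Q + P) * 10 ^ p.1.2.2 :=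
    Primrec.nat_add.comp
      (Primrec.nat_mul.comp (haQ.comp Primrec.fst) (hD.comp Primrec.snd))
      (Primrec.nat_mul.comp (hbP.comp Primrec.snd) (hD.comp Primrec.fst))
  have h3 : Primrec fun p : (ℕ × ℕ × ℕ) × (ℕ × ℕ × ℕ) =>
      (p.1.1 * Q + (Q + P)) * 10 ^ p.2.2.2 + (p.2.2.1 * Q) * 10 ^ p.1.2.2 :=
    Primrec.nat_add.comp
      (Primrec.nat_mul.comp (haP.comp Primrec.fst) (hD.comp Primrec.snd))
      (Primrec.nat_mul.comp (hbQ.comp Primrec.snd) (hD.comp Primrec.fst))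
  have h4 : Primrec fun p : (ℕ × ℕ × ℕ) × (ℕ × ℕ × ℕ) =>
      (p.2.1 * Q + (Q + P)) * 10 ^ p.1.2.2 + (p.1.2.1 * Q) * 10 ^ p.2.2.2 :=
    Primrec.nat_add.comp
      (Primrec.nat_mul.comp (haP.comp Primrec.snd) (hD.comp Primrec.fst))
      (Primrec.nat_mul.comp (hbQ.comp Primrec.fst) (hD.comp Primrec.snd))
  refine ((Primrec.nat_le.comp h1 h2).and (Primrec.nat_le.comp h3 h4)).of_eq fun p => ?_
  obtain ⟨⟨a, b, d⟩, a', b', d'⟩ := p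
  simp only [TripleLE, tripleLower, tripleUpper]
  have hQ : (0 : ℚ) < Q := by exact_mod_cast Nat.pos_of_ne_zero hQ0
  have hmul : ∀ s t : ℚ, s ≤ t ↔ s * Q ≤ t * Q := fun s t => (mul_le_mul_iff_of_pos_right hQ).symm
  rw [div_le_div_iff₀ (by positivity) (by positivity), div_le_div_iff₀ (by positivity)
    -- Multiplying by the denominator `Q` of `c`, and moving negative terms across, leaves
    -- inequalities between natural numbers.
    (by positivity), hmul ((_ - _ - c) * _), hmul ((_ + 1 + c) * _)]
  have hcQ : c * Q = P := by rw [hcPQ]; field_simp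
  have e1 : ∀ u v D : ℚ, (u - v - c) * D * Q = u * Q * D - (v * Q + P) * D := by
    intro u v D; rw [← hcQ]; ring
  have e2 : ∀ u v D : ℚ, (u - v + 1 + c) * D * Q = (u * Q + (Q + P)) * D - v * Q * D := by
    intro u v D; rw [← hcQ]; ring
  rw [e1, e1, e2, e2, sub_le_sub_iff, sub_le_sub_iff]
  norm_cast

/-! ### Nested decimal oracles -/

theorem mem_dom_iff {c : ℚ} (hc : 0 < c) {u : ℕ} :
    u ∈ (decimalBasis c).dom ↔ ∃ z : ℕ × ℕ × ℕ, 0 < z.2.2 ∧ u = tripleCode c z := by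
  constructor
  · rintro ⟨m, d, hd, h⟩
    obtain ⟨z, hz, hz'⟩ := exists_tripleCode_eq c m d
    refine ⟨z, hz ▸ hd, ?_⟩
    change iota u = _ at h
    rw [← hz'] at h
    have hlt : (tripleLower c z : ℝ) < tripleUpper c z := by
      exact_mod_cast tripleLower_lt_tripleUpper hc z
    -- Numbers that code no interval have empty `iota`. Nonemptiness thus makes `u` an interval
    -- code, and infimum and supremum recover its endpoints.
    have hne : (iota u).Nonempty := by
      rw [h, iota_tripleCode]
      exact Set.nonempty_Ioo.2 hlt
    obtain ⟨x, a, b, hu, hx⟩ := hne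
    have hab : (a : ℝ) < b := hx.1.trans hx.2
    rw [hu, iota_intervalCode, iota_tripleCode] at h
    have ha := congrArg sInf h
    have hb := congrArg sSup h
    rw [csInf_Ioo hab, csInf_Ioo hlt] at ha
    rw [csSup_Ioo hab, csSup_Ioo hlt] at hb
    rw [hu, Rat.cast_injective ha, Rat.cast_injective hb, tripleCode, decimalCode, tripleLower,
      tripleUpper]
    push_cast
    rw [sub_div, add_div _ c]
  · rintro ⟨z, hz, rfl⟩
    exact ⟨_, _, hz, rfl⟩

theorem decimalCode_mem_dom (c : ℚ) (m : ℤ) {d : ℕ} (hd : 0 < d) :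
    decimalCode c m d ∈ (decimalBasis c).dom := ⟨m, d, hd, rfl⟩

theorem isNestedOracle_of {c : ℚ} {φ : ℕ → ℕ} {x : ℝ} (hdom : ∀ m, φ m ∈ (decimalBasis c).dom)
    (hx : ∀ m, x ∈ iota (φ m)) (hnest : ∀ m, iota (φ (m + 1)) ⊆ iota (φ m))
    (hsmall : ∀ a b : ℝ, a < x → x < b → ∃ m, iota (φ m) ⊆ Set.Ioo a b) :
    (decimalBasis c).IsNestedOracle φ x := by
  refine ⟨⟨hdom, ?_, ?_, ?_⟩, hnest⟩
  · rintro _ ⟨_, ⟨m, rfl⟩, rfl⟩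
    exact hdom m
  · rintro _ ⟨_, ⟨m, rfl⟩, rfl⟩
    exact hx m
  · rintro _ ⟨m, d, _, rfl⟩ hxB
    rw [iota_decimalCode] at hxB ⊢
    obtain ⟨j, hj⟩ := hsmall _ _ hxB.1 hxB.2
    exact ⟨_, ⟨_, ⟨j, rfl⟩, rfl⟩, hj⟩

theorem exists_pow_small {c : ℚ} (hc : 0 < c) {ε : ℝ} (hε : 0 < ε) :
    ∃ N : ℕ, ∀ d ≥ N, (1 + 2 * (c : ℝ)) / 10 ^ d < ε := by
  have hc' : (0 : ℝ) < c := by exact_mod_cast hc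
  obtain ⟨N, hN⟩ := pow_unbounded_of_one_lt ((1 + 2 * (c : ℝ)) / ε) (by norm_num : (1 : ℝ) < 10)
  refine ⟨N, fun d hd => ?_⟩
  rw [div_lt_iff₀ hε] at hN
  rw [div_lt_iff₀ (by positivity)]
  have : (10 : ℝ) ^ N ≤ 10 ^ d := pow_le_pow_right₀ (by norm_num) hd
  nlinarith

theorem exists_iota_subset {c : ℚ} (hc : 0 < c) {x a b : ℝ} (ha : a < x) (hb : x < b) :
    ∃ N : ℕ, ∀ (m : ℤ) (d : ℕ), N ≤ d → x ∈ iota (decimalCode c m d) →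
      iota (decimalCode c m d) ⊆ Set.Ioo a b := by
  obtain ⟨N, hN⟩ := exists_pow_small hc (lt_min (sub_pos.2 ha) (sub_pos.2 hb))
  refine ⟨N, fun m d hd hx => ?_⟩
  have h := hN d hd
  rw [lt_min_iff] at h
  rw [iota_decimalCode] at hx ⊢
  have e : ((m + 1 + c) / 10 ^ d : ℝ) - (m - c) / 10 ^ d = (1 + 2 * (c : ℝ)) / 10 ^ d := by ring
  obtain ⟨h1, h2⟩ := hx
  exact Set.Ioo_subset_Ioo (by linarith) (by linarith)

theorem mem_iota_decimalCode_floor {c : ℚ} (hc : 0 < c) (x : ℝ) (d : ℕ) :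
    x ∈ iota (decimalCode c ⌊10 ^ d * x⌋ d) := by
  have hc' : (0 : ℝ) < c := by exact_mod_cast hc
  rw [iota_decimalCode, Set.mem_Ioo, div_lt_iff₀ (by positivity), lt_div_iff₀ (by positivity)]
  have h1 := Int.floor_le (10 ^ d * x)
  have h2 := Int.lt_floor_add_one (10 ^ d * x)
  constructor <;> linarith

/-- One further digit places `⌊10y⌋` between `10⌊y⌋` and `10⌊y⌋ + 9`, while the margin `c` shrinks
by the factor 10. -/
theorem standardOracle_antitone {c : ℚ} (hc : 0 < c) (x : ℝ) :
    Antitone fun l => iota (standardOracle c x l) := by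
  refine antitone_nat_of_succ_le fun l => ?_
  have hc' : (0 : ℝ) < c := by exact_mod_cast hc
  simp only [standardOracle, iota_decimalCode]
  have e : (10 : ℝ) ^ (l + 1 + 1) * x = 10 * (10 ^ (l + 1) * x) := by ring
  rw [e]
  set y := (10 : ℝ) ^ (l + 1) * x
  have h1 : 10 * ⌊y⌋ ≤ ⌊10 * y⌋ := by
    rw [Int.le_floor]
    push_cast
    linarith [Int.floor_le y]
  have h2 : ⌊10 * y⌋ < 10 * (⌊y⌋ + 1) := by
    rw [Int.floor_lt]
    push_cast
    linarith [Int.lt_floor_add_one y]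
  have h1' : (10 : ℝ) * ⌊y⌋ ≤ ⌊10 * y⌋ := by exact_mod_cast h1
  have h2' : (⌊10 * y⌋ : ℝ) + 1 ≤ 10 * (⌊y⌋ + 1) := by exact_mod_cast h2
  have hp : (0 : ℝ) < 10 ^ (l + 1) := by positivity
  refine Set.Ioo_subset_Ioo ?_ ?_
  · rw [div_le_div_iff₀ hp (by positivity), pow_succ _ (l + 1)]
    nlinarith
  · rw [div_le_div_iff₀ (by positivity) hp, pow_succ _ (l + 1)]
    nlinarith

/-- The summand `1/2` never carries into the next digit, so truncating the midpoint amounts to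
integer division of `m`. -/
theorem floor_midpoint (m : ℤ) {l d : ℕ} (hl : l ≤ d) :
    ⌊(10 : ℝ) ^ l * ((m + 1 / 2) / 10 ^ d)⌋ = m / 10 ^ (d - l) := by
  obtain ⟨e, rfl⟩ := Nat.exists_eq_add_of_le hl
  rw [Nat.add_sub_cancel_left, Int.floor_eq_iff, pow_add]
  have e1 : (10 : ℝ) ^ l * ((m + 1 / 2) / (10 ^ l * 10 ^ e)) = (m + 1 / 2) / 10 ^ e := by
    field_simp
  have hD : (0 : ℤ) < 10 ^ e := by positivity
  rw [e1, le_div_iff₀ (by positivity), div_lt_iff₀ (by positivity)]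
  have h1 := Int.ediv_mul_le m hD.ne'
  have h2 : m + 1 ≤ (m / 10 ^ e + 1) * 10 ^ e := Int.lt_ediv_add_one_mul_self m hD
  have h1' : ((m / 10 ^ e : ℤ) : ℝ) * 10 ^ e ≤ m := by exact_mod_cast h1
  have h2' : (m : ℝ) + 1 ≤ (((m / 10 ^ e : ℤ) : ℝ) + 1) * 10 ^ e := by exact_mod_cast h2
  constructor <;> linarith

theorem standardOracle_midpoint_pred (c : ℚ) {u d : ℕ} {p : ℝ} (h : IsDecimalCode c u p d) :
    standardOracle c p (d - 1) = u := by
  obtain ⟨m, hd, rfl, rfl⟩ := h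
  rw [standardOracle, Nat.sub_add_cancel hd, floor_midpoint m le_rfl]
  simp

/-- The standard oracle of the midpoint reaches `u` at `d - 1`; from there it can continue with the
standard oracle of any point of `u`, started at high enough precision to lie inside `u`. -/
theorem exists_nestedOracle_extending {c : ℚ} (hc : 0 < c) {u d : ℕ} {p x : ℝ}
    (h : IsDecimalCode c u p d) (hx : x ∈ iota u) :
    ∃ φ : ℕ → ℕ, (decimalBasis c).IsNestedOracle φ x ∧ ∀ l < d, φ l = standardOracle c p l := by
  have hu := standardOracle_midpoint_pred c h
  obtain ⟨m, hd, rfl, -⟩ := h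
  obtain ⟨N, hN⟩ : ∃ N, ∀ l, iota (standardOracle c x (N + l)) ⊆ iota (decimalCode c m d) := by
    rw [iota_decimalCode] at hx ⊢
    obtain ⟨N, hN⟩ := exists_iota_subset hc hx.1 hx.2
    exact ⟨N, fun l => hN _ _ (by omega) (mem_iota_decimalCode_floor hc x _)⟩
  have hmem : ∀ l < d, iota (decimalCode c m d) ⊆ iota (standardOracle c p l) := by
    intro l hl
    rw [← hu]
    exact standardOracle_antitone hc p (by omega)
  refine ⟨fun l => if l < d then standardOracle c p l else standardOracle c x (N + l),
    isNestedOracle_of (fun l => ?_) (fun l => ?_) (fun l => ?_) fun a b ha hb => ?_,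
    fun l hl => if_pos hl⟩
  · split_ifs <;> exact decimalCode_mem_dom _ _ (Nat.succ_pos _)
  · split_ifs with hl
    · exact hmem l hl hx
    · exact mem_iota_decimalCode_floor hc x _
  · by_cases hl : l < d
    · rw [if_pos hl]
      split_ifs with hl'
      · exact standardOracle_antitone hc p l.le_succ
      · exact (hN _).trans (hmem l hl)
    · rw [if_neg hl, if_neg (by omega)]
      exact standardOracle_antitone hc x (by omega)
  · obtain ⟨M, hM⟩ := exists_iota_subset hc ha hb
    refine ⟨M + d, ?_⟩
    rw [if_neg (by omega)]
    exact hM _ _ (by omega) (mem_iota_decimalCode_floor hc x _)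

/-- The triple of the value at `l` of the finite part of the standard oracle that is determined by
the triple `z`. -/
def truncatedTriple (z : ℕ × ℕ × ℕ) (l : ℕ) : ℕ × ℕ × ℕ :=
  ((z.1 + z.2.1 * (10 ^ (z.2.2 - (l + 1)) - 1)) / 10 ^ (z.2.2 - (l + 1)), z.2.1, l + 1)

theorem primrec_truncatedTriple : Primrec₂ truncatedTriple := by
  have ha : Primrec fun p : (ℕ × ℕ × ℕ) × ℕ => p.1.1 := Primrec.fst.comp Primrec.fst
  have hb : Primrec fun p : (ℕ × ℕ × ℕ) × ℕ => p.1.2.1 :=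
    Primrec.fst.comp (Primrec.snd.comp Primrec.fst)
  have hd : Primrec fun p : (ℕ × ℕ × ℕ) × ℕ => p.1.2.2 :=
    Primrec.snd.comp (Primrec.snd.comp Primrec.fst)
  have hl : Primrec fun p : (ℕ × ℕ × ℕ) × ℕ => p.2 + 1 := Primrec.succ.comp Primrec.snd
  have hD := Primrec.nat_pow.comp (Primrec.const 10) (Primrec.nat_sub.comp hd hl)
  exact (Primrec.nat_div.comp (Primrec.nat_add.comp ha (Primrec.nat_mul.comp hb
    (Primrec.nat_sub.comp hD (Primrec.const 1)))) hD).pair (hb.pair hl)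

/-- The midpoint of the decimal interval of a triple. -/
noncomputable def tripleMidpoint (z : ℕ × ℕ × ℕ) : ℝ :=
  (((z.1 : ℤ) - z.2.1 : ℤ) + 1 / 2) / 10 ^ z.2.2

theorem standardOracle_tripleMidpoint (c : ℚ) (z : ℕ × ℕ × ℕ) {l : ℕ} (hl : l < z.2.2) :
    standardOracle c (tripleMidpoint z) l = tripleCode c (truncatedTriple z l) := by
  obtain ⟨a, b, d⟩ := z
  simp only at hl
  rw [standardOracle, tripleMidpoint, floor_midpoint _ hl, tripleCode, truncatedTriple]
  simp only []
  congr 1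
  set D : ℕ := 10 ^ (d - (l + 1)) with hD
  have hD1 : 1 ≤ D := Nat.one_le_pow _ _ (by norm_num)
  have e : ((10 : ℤ) ^ (d - (l + 1))) = (D : ℤ) := by rw [hD]; push_cast; rfl
  rw [e]
  push_cast [hD1]
  -- Adding the multiple `b * D` keeps the numerator in `ℕ` and shifts the floor quotient of `a - b`
  -- by exactly `b`.
  rw [show (a : ℤ) + b * (D - 1) = a - b + b * D by ring,
    Int.add_mul_ediv_right _ _ (by omega)]
  ring

theorem isDecimalCode_iff (c : ℚ) (u : ℕ) (p : ℝ) (d : ℕ) : IsDecimalCode c u p d ↔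
    ∃ z : ℕ × ℕ × ℕ, 0 < z.2.2 ∧ d = z.2.2 ∧ u = tripleCode c z ∧ p = tripleMidpoint z := by
  constructor
  · rintro ⟨m, hd, rfl, rfl⟩
    refine ⟨(m.toNat, (-m).toNat, d), hd, rfl, ?_, ?_⟩
    · rw [tripleCode, Int.toNat_sub_toNat_neg]
    · rw [tripleMidpoint, Int.toNat_sub_toNat_neg]
  · rintro ⟨z, hd, rfl, rfl, rfl⟩
    exact ⟨_, hd, rfl, rfl⟩

/-! ### Programs with oracles: monotonicity, search, parameters -/

namespace OracleCode

variable {k : ℕ}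

theorem mem_eval_pair {φ : Fin k → ℕ →. ℕ} {f g : OracleCode k} {n v : ℕ} :
    v ∈ eval φ (pair f g) n ↔ ∃ a ∈ eval φ f n, ∃ b ∈ eval φ g n, v = Nat.pair a b := by
  simp only [eval, Seq.seq, Part.map_eq_map, Part.mem_bind_iff, Part.mem_map_iff]
  constructor
  · rintro ⟨_, ⟨a, ha, rfl⟩, b, hb, rfl⟩
    exact ⟨a, ha, b, hb, rfl⟩
  · rintro ⟨a, ha, b, hb, rfl⟩
    exact ⟨_, ⟨a, ha, rfl⟩, b, hb, rfl⟩

theorem mem_eval_comp {φ : Fin k → ℕ →. ℕ} {f g : OracleCode k} {n v : ℕ} :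
    v ∈ eval φ (comp f g) n ↔ ∃ a ∈ eval φ g n, v ∈ eval φ f a :=
  Part.mem_bind_iff

theorem eval_comp_of_eq {φ : Fin k → ℕ →. ℕ} {f g : OracleCode k} {n a : ℕ}
    (h : eval φ g n = Part.some a) : eval φ (comp f g) n = eval φ f a :=
  (congrArg (fun x => x >>= fun a => eval φ f a) h).trans (Part.bind_some _ _)

theorem eval_pair_of_eq {φ : Fin k → ℕ →. ℕ} {f g : OracleCode k} {n a b : ℕ}
    (hf : eval φ f n = Part.some a) (hg : eval φ g n = Part.some b) :
    eval φ (pair f g) n = Part.some (Nat.pair a b) := by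
  simp [eval, hf, hg, Seq.seq]

theorem mem_eval_rfind {φ : Fin k → ℕ →. ℕ} {f : OracleCode k} {a n : ℕ} :
    n ∈ eval φ (rfind f) a ↔ 0 ∈ eval φ f (Nat.pair a n) ∧
      ∀ m < n, ∃ v, v ≠ 0 ∧ v ∈ eval φ f (Nat.pair a m) := by
  refine Nat.mem_rfind.trans ?_
  simp only [Part.map_eq_map, Part.mem_map_iff]
  refine and_congr ⟨?_, fun h => ⟨0, h, rfl⟩⟩ (forall_congr' fun m => ?_)
  · rintro ⟨v, hv, h⟩
    simp only [decide_eq_true_eq] at h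
    exact h ▸ hv
  · refine ⟨fun H hm => ?_, fun H hm => ?_⟩
    · obtain ⟨v, hv, h⟩ := H hm
      exact ⟨v, by simpa using h, hv⟩
    · obtain ⟨v, h, hv⟩ := H hm
      exact ⟨v, hv, by simpa using h⟩

theorem eval_prec_zero (φ : Fin k → ℕ →. ℕ) (f g : OracleCode k) (a : ℕ) :
    eval φ (prec f g) (Nat.pair a 0) = eval φ f a := by
  simp [eval]

theorem eval_prec_succ (φ : Fin k → ℕ →. ℕ) (f g : OracleCode k) (a n : ℕ) :
    eval φ (prec f g) (Nat.pair a (n + 1)) = (eval φ (prec f g) (Nat.pair a n)).bind fun i =>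
      eval φ g (Nat.pair a (Nat.pair n i)) := by
  simp [eval]

/-- A halting computation consults its oracles only where they are defined, so extending them does
not change the result. -/
theorem eval_mono {φ φ' : Fin k → ℕ →. ℕ} (h : ∀ i n v, v ∈ φ i n → v ∈ φ' i n)
    (κ : OracleCode k) : ∀ {n v}, v ∈ eval φ κ n → v ∈ eval φ' κ n := by
  induction κ with
  | zero | succ | left | right => exact fun h => h
  | oracle i => exact h i _ _
  | pair f g hf hg =>
    intro n v hv
    obtain ⟨a, ha, b, hb, rfl⟩ := mem_eval_pair.1 hv
    exact mem_eval_pair.2 ⟨a, hf ha, b, hg hb, rfl⟩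
  | comp f g hf hg =>
    intro n v hv
    obtain ⟨a, ha, hb⟩ := mem_eval_comp.1 hv
    exact mem_eval_comp.2 ⟨a, hg ha, hf hb⟩
  | prec f g hf hg =>
    intro p
    obtain ⟨a, n, rfl⟩ : ∃ a n, Nat.pair a n = p := ⟨_, _, Nat.pair_unpair p⟩
    induction n with
    | zero =>
      rw [eval_prec_zero, eval_prec_zero]
      exact fun h => hf h
    | succ n ih =>
      intro v
      rw [eval_prec_succ, eval_prec_succ, Part.mem_bind_iff, Part.mem_bind_iff]
      rintro ⟨i, hi, hv⟩
      exact ⟨i, ih hi, hg hv⟩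
  | rfind f hf =>
    intro a n hn
    obtain ⟨h0, h1⟩ := mem_eval_rfind.1 hn
    refine mem_eval_rfind.2 ⟨hf h0, fun m hm => ?_⟩
    obtain ⟨v, hv, hv'⟩ := h1 m hm
    exact ⟨v, hv, hf hv'⟩

/-- Every partial recursive function is computed by a program that does not call the oracles. -/
theorem exists_eval_eq_of_partrec {f : ℕ →. ℕ} (hf : Nat.Partrec f) :
    ∃ κ : OracleCode k, ∀ φ, eval φ κ = f := by
  induction hf with
  | zero => exact ⟨zero, fun _ => rfl⟩
  | succ => exact ⟨succ, fun _ => rfl⟩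
  | left => exact ⟨left, fun _ => rfl⟩
  | right => exact ⟨right, fun _ => rfl⟩
  | pair _ _ h1 h2 =>
    obtain ⟨a, ha⟩ := h1
    obtain ⟨b, hb⟩ := h2
    exact ⟨pair a b, fun φ => by simp only [eval, ha, hb]; rfl⟩
  | comp _ _ h1 h2 =>
    obtain ⟨a, ha⟩ := h1
    obtain ⟨b, hb⟩ := h2
    exact ⟨comp a b, fun φ => by simp only [eval, ha, hb]; rfl⟩
  | prec _ _ h1 h2 =>
    obtain ⟨a, ha⟩ := h1
    obtain ⟨b, hb⟩ := h2
    exact ⟨prec a b, fun φ => by simp only [eval, ha, hb]; rfl⟩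
  | rfind _ h1 =>
    obtain ⟨a, ha⟩ := h1
    exact ⟨rfind a, fun φ => by simp only [eval, ha]; rfl⟩

theorem exists_eval_eq_of_computable {f : ℕ → ℕ} (hf : Computable f) :
    ∃ κ : OracleCode k, ∀ φ n, eval φ κ n = Part.some (f n) := by
  obtain ⟨κ, h⟩ := exists_eval_eq_of_partrec (k := k) (Partrec.nat_iff.1 hf.partrec)
  exact ⟨κ, fun φ n => by rw [h]; rfl⟩

/-- A program for the constant function `n`. -/
def const : ℕ → OracleCode k
  | 0 => zero
  | n + 1 => comp succ (const n)

theorem eval_const (φ : Fin k → ℕ →. ℕ) (n m : ℕ) : eval φ (const n) m = Part.some n := by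
  induction n with
  | zero => rfl
  | succ n ih => simp [const, eval, ih]

/-- The program that runs `κ` on the pair of the constant `n` and the argument. -/
def curry (κ : OracleCode k) (n : ℕ) : OracleCode k := comp κ (pair (const n) (pair left right))

theorem eval_curry (φ : Fin k → ℕ →. ℕ) (κ : OracleCode k) (n m : ℕ) :
    eval φ (curry κ n) m = eval φ κ (Nat.pair n m) := by
  rw [curry, eval_comp_of_eq (eval_pair_of_eq (eval_const φ n m)
    (eval_pair_of_eq (a := m.unpair.1) (b := m.unpair.2) rfl rfl)), Nat.pair_unpair]

theorem primrec_toNat_const : Primrec fun n => (const n : OracleCode k).toNat := by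
  have h : Primrec₂ fun (_ : ℕ) (q : ℕ) => Nat.pair 6 (Nat.pair (Nat.pair 1 0) q) :=
    (Primrec₂.natPair.comp (Primrec.const 6)
      (Primrec₂.natPair.comp (Primrec.const (Nat.pair 1 0)) Primrec.snd)).to₂
  refine (Primrec.nat_rec₁ (Nat.pair 0 0) h).of_eq fun n => ?_
  induction n with
  | zero => rfl
  | succ n ih => simp only [const, toNat, ← ih]

theorem primrec_toNat_curry (κ : OracleCode k) : Primrec fun n => (curry κ n).toNat := by
  exact Primrec₂.natPair.comp (Primrec.const 6) (Primrec₂.natPair.comp (Primrec.const κ.toNat)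
    (Primrec₂.natPair.comp (Primrec.const 5) (Primrec₂.natPair.comp primrec_toNat_const
      (Primrec.const (pair left right : OracleCode k).toNat))))

/-- There is a program for the list of the values of all oracles. -/
theorem exists_eval_eq_oracles (L : List (Fin k)) : ∃ κ : OracleCode k,
    ∀ (φ : Fin k → ℕ → ℕ) (t : ℕ), eval (fun i => (φ i : ℕ →. ℕ)) κ t =
      Part.some (Encodable.encode (L.map fun i => φ i t)) := by
  induction L with
  | nil => exact ⟨zero, fun _ _ => rfl⟩
  | cons i L ih =>
    obtain ⟨κ, hκ⟩ := ih
    refine ⟨comp succ (pair (oracle i) κ), fun φ t => ?_⟩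
    rw [eval_comp_of_eq (eval_pair_of_eq (a := φ i t) rfl (hκ φ t))]
    rfl

/-- Unbounded search for a number that satisfies a computable predicate, which may depend on the
values of the oracles at one argument. -/
theorem exists_search {p : ℕ → List ℕ → ℕ → Bool}
    (hp : Computable fun q : ℕ × List ℕ × ℕ => p q.1 q.2.1 q.2.2) :
    ∃ κ : OracleCode k, ∀ (φ : Fin k → ℕ → ℕ) (a : ℕ),
      (∃ t w, p a (List.ofFn fun i => φ i t) w = true) →
      ∃ t w, p a (List.ofFn fun i => φ i t) w = true ∧
        w ∈ eval (fun i => (φ i : ℕ →. ℕ)) κ a := by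
  obtain ⟨κo, ho⟩ := exists_eval_eq_oracles (List.finRange k)
  have hF : Computable fun n : ℕ =>
      cond (p n.unpair.1.unpair.1 ((Encodable.decode (α := List ℕ) n.unpair.2).getD [])
        n.unpair.1.unpair.2.unpair.2) 0 1 := by
    have h1 : Primrec fun n : ℕ => n.unpair.1 := Primrec.fst.comp Primrec.unpair
    have h2 : Primrec fun n : ℕ => n.unpair.2 := Primrec.snd.comp Primrec.unpair
    have hV := Primrec.option_getD.comp ((Primrec.decode (α := List ℕ)).comp h2)
      (Primrec.const [])
    have hT := (h1.comp h1).pair (hV.pair (h2.comp (h2.comp h1)))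
    have hpT := Computable.comp hp hT.to_comp
    simp only [] at hpT
    exact Computable.cond hpT (Computable.const 0) (Computable.const 1)
  obtain ⟨κF, hκF⟩ := exists_eval_eq_of_computable (k := k) hF
  -- The search variable codes the pair `(t, w)`; `κo` queries all oracles at `t`, `κF` returns 0 on
  -- success, and `right` extracts `w`.
  refine ⟨comp right (rfind (comp κF (pair (pair left right) (comp κo (comp left right))))), ?_⟩
  rintro φ a ⟨t, w, hw⟩
  set Φ : Fin k → ℕ →. ℕ := fun i => (φ i : ℕ →. ℕ) with hΦ
  have key : ∀ n, eval Φ (comp κF (pair (pair left right) (comp κo (comp left right))))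
      (Nat.pair a n) =
      Part.some (cond (p a (List.ofFn fun i => φ i n.unpair.1) n.unpair.2) 0 1) := by
    intro n
    have e : ∀ t, (List.finRange k).map (fun i => φ i t) = List.ofFn fun i => φ i t := fun t => by
      rw [List.ofFn_eq_map]
    have h1 : eval Φ (pair left right) (Nat.pair a n) = Part.some (Nat.pair a n) := by
      rw [eval_pair_of_eq (a := (Nat.pair a n).unpair.1) (b := (Nat.pair a n).unpair.2) rfl rfl,
        Nat.pair_unpair]
    have h2 : eval Φ (comp left right) (Nat.pair a n) = Part.some n.unpair.1 := by
      rw [eval_comp_of_eq (a := (Nat.pair a n).unpair.2) rfl, Nat.unpair_pair]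
      rfl
    rw [eval_comp_of_eq (eval_pair_of_eq h1 ((eval_comp_of_eq h2).trans (ho φ _))), hκF]
    simp [e]
  have hex : ∃ n : ℕ, p a (List.ofFn fun i => φ i n.unpair.1) n.unpair.2 = true :=
    ⟨Nat.pair t w, by simpa using hw⟩
  classical
  refine ⟨(Nat.find hex).unpair.1, (Nat.find hex).unpair.2, Nat.find_spec hex,
    mem_eval_comp.2 ⟨Nat.find hex, mem_eval_rfind.2 ⟨?_, fun m hm => ⟨1, one_ne_zero, ?_⟩⟩, ?_⟩⟩
  · rw [key, Nat.find_spec hex]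
    exact Part.mem_some _
  · rw [key, Bool.eq_false_iff.2 (Nat.find_min hex hm)]
    exact Part.mem_some _
  · exact Part.mem_some _

/-- The results of a program are partial recursive in the parameters of its oracles. -/
theorem partrec_eval {α : Type*} [Primcodable α] {φ : α → Fin k → ℕ →. ℕ}
    (hφ : ∀ i, Partrec₂ fun a n => φ a i n) (κ : OracleCode k) :
    Partrec₂ fun a n => eval (φ a) κ n := by
  induction κ with
  | zero => exact (Computable.const 0).partrec
  | succ => exact (Computable.succ.comp Computable.snd).partrec
  | left => exact (Computable.fst.comp (Computable.unpair.comp Computable.snd)).partrec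
  | right => exact (Computable.snd.comp (Computable.unpair.comp Computable.snd)).partrec
  | oracle i => exact hφ i
  | pair f g hf hg =>
    refine Partrec.of_eq (f := fun p : α × ℕ => (eval (φ p.1) f p.2).bind fun a =>
      (eval (φ p.1) g p.2).map fun b => Nat.pair a b) ?_ fun p => ?_
    · refine Partrec.bind hf (Partrec.map (hg.comp (Computable.fst.comp Computable.fst)
        (Computable.snd.comp Computable.fst)) ?_)
      exact Primrec₂.natPair.to_comp.comp (Computable.snd.comp Computable.fst) Computable.snd
    · simp [eval, Seq.seq, Part.bind_map]
  | comp f g hf hg =>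
    exact Partrec.bind hg (hf.comp (Computable.fst.comp Computable.fst) Computable.snd)
  | prec f g hf hg =>
    have h1 : Computable fun p : α × ℕ => p.2.unpair.1 :=
      Computable.fst.comp (Computable.unpair.comp Computable.snd)
    have h2 : Computable fun p : α × ℕ => p.2.unpair.2 :=
      Computable.snd.comp (Computable.unpair.comp Computable.snd)
    refine Partrec.of_eq (Partrec.nat_rec h2 (hf.comp Computable.fst h1)
      (h := fun p y => eval (φ p.1) g (Nat.pair p.2.unpair.1 (Nat.pair y.1 y.2))) ?_) fun p => ?_
    · refine hg.comp (Computable.fst.comp Computable.fst)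
        (Primrec₂.natPair.to_comp.comp (h1.comp Computable.fst)
          (Primrec₂.natPair.to_comp.comp (Computable.fst.comp Computable.snd)
            (Computable.snd.comp Computable.snd)))
    · rfl
  | rfind f hf =>
    refine Partrec.rfind (p := fun (p : α × ℕ) n =>
      (fun m => decide (m = 0)) <$> eval (φ p.1) f (Nat.pair p.2 n)) ?_
    refine Partrec.map (hf.comp (Computable.fst.comp Computable.fst)
      (Primrec₂.natPair.to_comp.comp (Computable.snd.comp Computable.fst) Computable.snd)) ?_
    exact (Primrec.eq.decide.comp (Primrec.snd (α := (α × ℕ) × ℕ))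
      (Primrec.const 0)).to_comp

end OracleCode

/-! ### Soundness of `R` and uniqueness of the represented function -/

/-- The finite oracles extend to nested oracles for `x`, and the output interval computed from them
is then also a value of a nested oracle for `ψ x j`. -/
theorem mem_iota_of_mem_constructedStates {k l : ℕ} {c : ℚ} (hc : 0 < c)
    {ψ : (Fin k → ℝ) → (Fin l → ℝ)} {κ : Fin l → OracleCode k}
    (hκ : ComputesOnNestedOracles c ψ κ) {u : Fin (k + l) → ℕ}
    (hu : tupleCode (k + l) u ∈ constructedStates c κ) {x : Fin k → ℝ}
    (hx : ∀ i, x i ∈ iota (u (Fin.castAdd l i))) (j : Fin l) :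
    ψ x j ∈ iota (u (Fin.natAdd k j)) := by
  obtain ⟨u', huu, p, d, hpd, hj⟩ := hu
  obtain rfl := tupleCode_injective _ huu
  choose φ hφ hφσ using fun i => exists_nestedOracle_extending hc (hpd i) (hx i)
  obtain ⟨f, hf, hfo⟩ := hκ x φ hφ j
  obtain ⟨m, hm⟩ := hj j
  have h := OracleCode.eval_mono (φ' := fun i => (φ i : ℕ →. ℕ)) (fun i n v hv => by
    obtain ⟨hn, rfl⟩ := hv
    rw [PFun.coe_val, Part.mem_some_iff]
    exact (hφσ i n hn).symm) _ hm
  rw [Part.mem_unique h (hf m)]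
  exact hfo.1.2.2.1 _ ⟨_, ⟨m, rfl⟩, rfl⟩

theorem coding_power_tupleCode {X : Type*} (T : CodedBasis X) (n : ℕ) (u : Fin n → ℕ) :
    (T.power n).coding (tupleCode n u) = Set.univ.pi fun i => T.coding (u i) := by
  ext x
  constructor
  · rintro ⟨a, ha, hx⟩ i _
    rw [tupleCode_injective _ ha]
    exact hx i
  · intro hx
    exact ⟨u, rfl, fun i => hx i trivial⟩

/-- A point of a set with a basic representation `R` has arbitrarily small neighborhoods with codes
in `R`. -/
theorem exists_mem_of_isBasicRepresentation {X : Type*} {T : CodedBasis X} {n : ℕ} {R : Set ℕ}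
    {A : Set (Fin n → X)} (hR : (T.power n).IsBasicRepresentation R A) {y : Fin n → X}
    (hy : y ∈ A) {v : Fin n → ℕ} (hv : ∀ i, v i ∈ T.dom) (hyv : ∀ i, y i ∈ T.coding (v i)) :
    ∃ u, tupleCode n u ∈ R ∧ (∀ i, u i ∈ T.dom) ∧ (∀ i, y i ∈ T.coding (u i)) ∧
      ∀ i, T.coding (u i) ⊆ T.coding (v i) := by
  obtain ⟨L, ⟨-, hL1, hL2⟩, hLR⟩ := (hR.2 y).1 hy
  obtain ⟨U, hU, hUB⟩ := hL2 (Set.univ.pi fun i => T.coding (v i)) ⟨_, hv, rfl⟩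
    fun i _ => hyv i
  have hyU := hL1 U hU
  obtain ⟨r, hr, rfl⟩ := hLR hU
  obtain ⟨u, rfl, hyu⟩ := hyU
  rw [coding_power_tupleCode] at hUB
  have hne : (Set.univ.pi fun i => T.coding (u i)).Nonempty := ⟨y, fun i _ => hyu i⟩
  refine ⟨u, hr, fun i => ?_, hyu, fun i => ?_⟩
  · obtain ⟨b, hb, hub⟩ := hR.1 hr
    rw [coding_power_tupleCode] at hub
    -- Membership in the domain is an equality of product sets; as the product is nonempty,
    -- projecting recovers each factor.
    have h1 := congrArg (fun s => Function.eval i '' s) hub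
    rw [Set.eval_image_univ_pi hne, Set.eval_image_univ_pi (hub ▸ hne)] at h1
    change T.coding (u i) ∈ T.basis
    rw [h1]
    exact hb i
  · rcases Set.univ_pi_subset_univ_pi_iff.1 hUB with h | ⟨i', h⟩
    · exact h i
    · exact absurd (hyu i') (h ▸ Set.notMem_empty _)

/-- If the values differed at `x`, a box of `R` around the point of the graph of `ψ` could be made
small enough to miss `ψ' x j`, contradicting soundness for `ψ'`. -/
theorem graph_unique_of_isBasicRepresentation {k l : ℕ} {c : ℚ} (hc : 0 < c)
    {ψ ψ' : (Fin k → ℝ) → (Fin l → ℝ)} {κ : Fin l → OracleCode k}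
    (hκ : ComputesOnNestedOracles c ψ' κ)
    (hR : ((decimalBasis c).power (k + l)).IsBasicRepresentation (constructedStates c κ)
      (graphSet ψ)) : ψ = ψ' := by
  funext x j
  by_contra hne
  -- Taking `ψ' x j` itself as an endpoint excludes it, since the interval is open.
  obtain ⟨a, b, hab, ha, hb⟩ : ∃ a b : ℝ, ψ' x j ∉ Set.Ioo a b ∧ a < ψ x j ∧ ψ x j < b := by
    rcases lt_or_gt_of_ne hne with h | h
    · exact ⟨ψ x j - 1, ψ' x j, fun h' => h'.2.false, by linarith, h⟩
    · exact ⟨ψ' x j, ψ x j + 1, fun h' => h'.1.false, h, by linarith⟩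
  obtain ⟨N, hN⟩ := exists_iota_subset hc ha hb
  set y : Fin (k + l) → ℝ := Fin.append x (ψ x) with hy
  have hyA : y ∈ graphSet ψ := by
    simp [graphSet, hy]
  obtain ⟨u, hu, -, hyu, huv⟩ := exists_mem_of_isBasicRepresentation hR hyA
    (v := fun i => standardOracle c (y i) N) (fun i => decimalCode_mem_dom _ _ N.succ_pos)
    fun i => mem_iota_decimalCode_floor hc (y i) _
  have h1 := mem_iota_of_mem_constructedStates hc hκ hu (x := x) (fun i => by
    have := hyu (Fin.castAdd l i)
    rwa [hy, Fin.append_left] at this) j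
  have h2 := huv (Fin.natAdd k j) h1
  have e : y (Fin.natAdd k j) = ψ x j := by simp [hy]
  simp only [e] at h2
  exact hab (hN _ _ N.le_succ (mem_iota_decimalCode_floor hc _ _) h2)

/-! ### The predictor: searching `R` for better approximations -/

open Nat.Partrec (Code)

section Decoding

variable {α : Type*} [Primcodable α]

/-- The code of an object, for the coding that belongs to `Primcodable α`. -/
def primcode (a : α) : ℕ := Encodable.encode a

theorem primrec_primcode : Primrec (primcode : α → ℕ) := Primrec.encode

theorem primcode_injective : Function.Injective (primcode : α → ℕ) := Encodable.encode_injective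

/-- The object with the given code, or a default value. -/
def decodeD (α : Type*) [Primcodable α] [Inhabited α] (n : ℕ) : α :=
  (Encodable.decode (α := α) n).getD default

variable [Inhabited α]

theorem decodeD_encode (a : α) : decodeD α (Encodable.encode a) = a := by
  simp [decodeD]

theorem decodeD_primcode (a : α) : decodeD α (primcode a) = a := decodeD_encode a

theorem primrec_decodeD : Primrec (decodeD α) :=
  Primrec.option_getD_default.comp Primrec.decode

end Decoding

/-- The condition on the triples `w` that are sought in order to improve the approximation `q` of
the `j`-th coordinate of the value of a function, if the list `V` holds values of oracles for the
argument and `e` semi-decides the representation. -/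
def SearchCondition (c : ℚ) (l j : ℕ) (a : Code × ℕ × Option (ℕ × ℕ × ℕ)) (V : List ℕ)
    (w : ℕ × List ((ℕ × ℕ × ℕ) × (ℕ × ℕ × ℕ)) × List (ℕ × ℕ × ℕ)) : Prop :=
  V = w.2.1.map (fun p => tripleCode c p.1) ∧
  (∀ p ∈ w.2.1, TripleLE c p.1 p.2) ∧
  (Code.evaln w.1 a.1 (listTupleCode (w.2.1.map (fun p => tripleCode c p.2) ++
    w.2.2.map (tripleCode c)))).isSome = true ∧
  w.2.2.length = l ∧
  a.2.1 < (w.2.2.getD j default).2.2 ∧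
  ∀ z ∈ a.2.2.toList, TripleLE c (w.2.2.getD j default) z

theorem primrecPred_searchCondition {c : ℚ} (hc : 0 < c) (l j : ℕ) :
    PrimrecPred fun q : (Code × ℕ × Option (ℕ × ℕ × ℕ)) × List ℕ ×
      (ℕ × List ((ℕ × ℕ × ℕ) × (ℕ × ℕ × ℕ)) × List (ℕ × ℕ × ℕ)) =>
      SearchCondition c l j q.1 q.2.1 q.2.2 := by
  have ht := primrec_tripleCode hc
  have hw := (Primrec.snd (α := List ℕ)
    (β := ℕ × List ((ℕ × ℕ × ℕ) × (ℕ × ℕ × ℕ)) × List (ℕ × ℕ × ℕ))).comp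
    (Primrec.snd (α := Code × ℕ × Option (ℕ × ℕ × ℕ)))
  have hw1 := Primrec.fst.comp (Primrec.snd.comp hw)
  have hw2 := Primrec.snd.comp (Primrec.snd.comp hw)
  have ha := Primrec.fst (α := Code × ℕ × Option (ℕ × ℕ × ℕ))
    (β := List ℕ × ℕ × List ((ℕ × ℕ × ℕ) × (ℕ × ℕ × ℕ)) × List (ℕ × ℕ × ℕ))
  have hj := (Primrec.list_getD (default : ℕ × ℕ × ℕ)).comp hw2 (Primrec.const j)
  have hL := Primrec.list_append.comp
    (Primrec.list_map hw1 (ht.comp (Primrec.snd.comp Primrec.snd)).to₂)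
    (Primrec.list_map hw2 (ht.comp Primrec.snd).to₂)
  have hall : PrimrecPred fun L : List ((ℕ × ℕ × ℕ) × (ℕ × ℕ × ℕ)) =>
      ∀ p ∈ L, TripleLE c p.1 p.2 :=
    PrimrecPred.forall_mem_list (primrecRel_tripleLE hc)
  have hall' := (PrimrecRel.forall_mem_list (primrecRel_tripleLE hc).swap)
  refine PrimrecPred.and ?_ (PrimrecPred.and ?_ (PrimrecPred.and ?_ (PrimrecPred.and ?_
    (PrimrecPred.and ?_ ?_))))
  · exact Primrec.eq.comp (Primrec.fst.comp Primrec.snd)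
      (Primrec.list_map hw1 (ht.comp (Primrec.fst.comp Primrec.snd)).to₂)
  · exact hall.comp hw1
  · exact Primrec.eq.comp (Primrec.option_isSome.comp (Code.primrec_evaln.comp
      (((Primrec.fst.comp hw).pair (Primrec.fst.comp ha)).pair
        (primrec_listTupleCode.comp hL)))) (Primrec.const true)
  · exact Primrec.eq.comp (Primrec.list_length.comp hw2) (Primrec.const l)
  · exact Primrec.nat_lt.comp (Primrec.fst.comp (Primrec.snd.comp ha))
      (Primrec.snd.comp (Primrec.snd.comp hj))
  · exact hall'.comp (Primrec.optionToList.comp (Primrec.snd.comp (Primrec.snd.comp ha))) hj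

theorem exists_eq_ofFn {α : Type*} {n : ℕ} {L : List α} (h : L.length = n) :
    ∃ g : Fin n → α, L = List.ofFn g := by
  subst h
  exact ⟨L.get, (List.ofFn_get L).symm⟩

/-- `R` determines the values of `ψ`: neighborhoods with codes in `R` of points of the graph are
arbitrarily small, and contain a point of the graph over each point of their first factors. -/
def IsPredictive {k l : ℕ} (c : ℚ) (R : Set ℕ) (ψ : (Fin k → ℝ) → (Fin l → ℝ)) : Prop :=
  (∀ (u : Fin (k + l) → ℕ) (x : Fin k → ℝ), tupleCode (k + l) u ∈ R →
    (∀ i, x i ∈ iota (u (Fin.castAdd l i))) → ∀ j, ψ x j ∈ iota (u (Fin.natAdd k j))) ∧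
  ∀ (x : Fin k → ℝ) (d : ℕ), ∃ z : Fin (k + l) → ℕ × ℕ × ℕ,
    tupleCode (k + l) (fun i => tripleCode c (z i)) ∈ R ∧
    (∀ i, 0 < (z (Fin.castAdd l i)).2.2 ∧ x i ∈ iota (tripleCode c (z (Fin.castAdd l i)))) ∧
    ∀ j, iota (tripleCode c (z (Fin.natAdd k j))) ⊆ iota (standardOracle c (ψ x j) d)

theorem isPredictive_of_isBasicRepresentation {k l : ℕ} {c : ℚ} (hc : 0 < c)
    {ψ ψ' : (Fin k → ℝ) → (Fin l → ℝ)} {κ : Fin l → OracleCode k}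
    (hκ : ComputesOnNestedOracles c ψ' κ)
    (hR : ((decimalBasis c).power (k + l)).IsBasicRepresentation (constructedStates c κ)
      (graphSet ψ)) : IsPredictive c (constructedStates c κ) ψ := by
  obtain rfl := graph_unique_of_isBasicRepresentation hc hκ hR
  refine ⟨fun u x hu hx j => mem_iota_of_mem_constructedStates hc hκ hu hx j, fun x d => ?_⟩
  set y : Fin (k + l) → ℝ := Fin.append x (ψ x) with hy
  have hyA : y ∈ graphSet ψ := by
    simp [graphSet, hy]
  obtain ⟨u, hu, hud, hyu, huv⟩ := exists_mem_of_isBasicRepresentation hR hyA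
    (v := fun i => standardOracle c (y i) d) (fun i => decimalCode_mem_dom _ _ d.succ_pos)
    fun i => mem_iota_decimalCode_floor hc (y i) _
  choose z hz huz using fun i => (mem_dom_iff hc).1 (hud i)
  obtain rfl : u = fun i => tripleCode c (z i) := funext huz
  refine ⟨z, hu, fun i => ⟨hz _, ?_⟩, fun j => ?_⟩
  · have := hyu (Fin.castAdd l i)
    rwa [hy, Fin.append_left] at this
  · have := huv (Fin.natAdd k j)
    have e : y (Fin.natAdd k j) = ψ x j := by simp [hy]
    rwa [e] at this

/-- Correctness of a hit: the input intervals of the tuple include oracle values, hence contain the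
`x i`, so soundness of `R` applies. -/
theorem mem_of_searchCondition {k l : ℕ} {c : ℚ} (hc : 0 < c) {R : Set ℕ}
    {ψ : (Fin k → ℝ) → (Fin l → ℝ)} (hR : IsPredictive c R ψ) {e : Code} (he : SemiDecides e R)
    {x : Fin k → ℝ} {φ : Fin k → ℕ → ℕ}
    (hφ : ∀ i, (decimalBasis c).IsNestedOracle (φ i) (x i)) {j : Fin l} {m t : ℕ}
    {q : Option (ℕ × ℕ × ℕ)} {w : ℕ × List ((ℕ × ℕ × ℕ) × (ℕ × ℕ × ℕ)) × List (ℕ × ℕ × ℕ)}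
    (h : SearchCondition c l j (e, m, q) (List.ofFn fun i => φ i t) w) :
    ψ x j ∈ iota (tripleCode c (w.2.2.getD j default)) := by
  obtain ⟨n, w1, w2⟩ := w
  obtain ⟨h1, h2, h3, h4, -, -⟩ := h
  simp only [] at h1 h2 h3 h4 ⊢
  obtain ⟨g2, rfl⟩ := exists_eq_ofFn h4
  have hlen : w1.length = k := by
    have := congrArg List.length h1
    simpa using this.symm
  obtain ⟨g1, rfl⟩ := exists_eq_ofFn hlen
  rw [List.map_ofFn, List.ofFn_inj] at h1
  rw [List.map_ofFn, List.map_ofFn, ← List.ofFn_fin_append, listTupleCode_ofFn] at h3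
  obtain ⟨v, hv⟩ := Option.isSome_iff_exists.1 h3
  have hmem := (he _).1 (Part.dom_iff_mem.2 ⟨v, Code.evaln_sound hv⟩)
  have := hR.1 _ x hmem (fun i => by
    rw [Fin.append_left]
    refine (tripleLE_iff hc _ _).1 (h2 _ (List.mem_ofFn.2 ⟨i, rfl⟩)) ?_
    have h5 := congrFun h1 i
    simp only [Function.comp_apply] at h5
    rw [← h5]
    exact (hφ i).1.2.2.1 _ ⟨_, ⟨t, rfl⟩, rfl⟩) j
  rw [Fin.append_right] at this
  have e : (List.ofFn g2).getD j default = g2 j := by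
    simp [List.getD_eq_getElem?_getD]
  rw [e]
  exact this

/-- Termination of the search: `R` has boxes small enough in the output coordinates, and the oracles
eventually enter their input intervals. -/
theorem exists_searchCondition {k l : ℕ} {c : ℚ} (hc : 0 < c) {R : Set ℕ}
    {ψ : (Fin k → ℝ) → (Fin l → ℝ)} (hR : IsPredictive c R ψ) {e : Code} (he : SemiDecides e R)
    {x : Fin k → ℝ} {φ : Fin k → ℕ → ℕ}
    (hφ : ∀ i, (decimalBasis c).IsNestedOracle (φ i) (x i)) (j : Fin l) (m : ℕ)
    {q : Option (ℕ × ℕ × ℕ)} (hq : ∀ z ∈ q, ψ x j ∈ iota (tripleCode c z)) :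
    ∃ t w, SearchCondition c l j (e, m, q) (List.ofFn fun i => φ i t) w := by
  obtain ⟨N, hN⟩ : ∃ N, ∀ d ≥ N, ∀ z ∈ q,
      iota (standardOracle c (ψ x j) d) ⊆ iota (tripleCode c z) := by
    cases q with
    | none => exact ⟨0, fun _ _ z hz => by simp at hz⟩
    | some z =>
      have h := hq z rfl
      rw [iota_tripleCode] at h
      obtain ⟨N, hN⟩ := exists_iota_subset hc h.1 h.2
      refine ⟨N, fun d hd z' hz' => ?_⟩
      obtain rfl : z = z' := by simpa using hz'
      rw [iota_tripleCode]
      exact hN _ _ (by omega) (mem_iota_decimalCode_floor hc _ _)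
  obtain ⟨z, hzR, hzx, hzψ⟩ := hR.2 x (max N m)
  have hzψj := hzψ j
  -- The length `(1 + 2c) / 10 ^ d` determines the number of digits, so an included interval has at
  -- least as many digits.
  have hdig : m < (z (Fin.natAdd k j)).2.2 := by
    obtain ⟨w, hw, hw'⟩ := exists_tripleCode_eq c ⌊10 ^ (max N m + 1) * ψ x j⌋ (max N m + 1)
    rw [standardOracle, ← hw', ← tripleLE_iff hc] at hzψj
    have h1 := tripleUpper_sub_tripleLower c (z (Fin.natAdd k j))
    have h2 := tripleUpper_sub_tripleLower c w
    have h3 : (1 + 2 * c) / 10 ^ (z (Fin.natAdd k j)).2.2 ≤ (1 + 2 * c) / 10 ^ w.2.2 := by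
      rw [← h1, ← h2]
      exact sub_le_sub hzψj.2 hzψj.1
    rw [div_le_div_iff_of_pos_left (by positivity) (by positivity) (by positivity),
      pow_le_pow_iff_right₀ (by norm_num)] at h3
    omega
  have hlocal : ∀ i, ∃ t, ∀ t' ≥ t, iota (φ i t') ⊆ iota (tripleCode c (z (Fin.castAdd l i))) := by
    intro i
    obtain ⟨-, -, h⟩ := (hφ i).1.2
    obtain ⟨_, ⟨_, ⟨t, rfl⟩, rfl⟩, ht⟩ := h _ ((mem_dom_iff hc).2 ⟨_, (hzx i).1, rfl⟩) (hzx i).2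
    refine ⟨t, fun t' htt' => ?_⟩
    have h1 : iota (φ i t') ⊆ iota (φ i t) :=
      antitone_nat_of_succ_le (f := fun m => iota (φ i m)) (hφ i).2 htt'
    exact h1.trans ht
  choose t ht using hlocal
  -- The search queries all oracles at one common argument; nestedness allows passing to the
  -- maximum.
  obtain ⟨M, hM⟩ : ∃ M, ∀ i, t i ≤ M :=
    ⟨Finset.univ.sup t, fun i => Finset.le_sup (Finset.mem_univ i)⟩
  choose w hwd hw using fun i => (mem_dom_iff hc).1 ((hφ i).1.1 M)
  obtain ⟨v, hv⟩ := Part.dom_iff_mem.1 ((he _).2 hzR)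
  obtain ⟨n, hn⟩ := Code.evaln_complete.1 hv
  have e1 : (List.ofFn fun j => z (Fin.natAdd k j)).getD j default = z (Fin.natAdd k j) := by
    simp [List.getD_eq_getElem?_getD]
  refine ⟨M, (n, List.ofFn (fun i => (w i, z (Fin.castAdd l i))),
    List.ofFn fun j => z (Fin.natAdd k j)), ?_, ?_, ?_, ?_, ?_, ?_⟩
  · simp only [List.map_ofFn]
    congr 1
    funext i
    exact hw i
  · simp only [List.forall_mem_ofFn_iff]
    intro i
    rw [tripleLE_iff hc, ← hw]
    exact ht i M (hM i)
  · simp only [List.map_ofFn]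
    rw [← List.ofFn_fin_append, listTupleCode_ofFn]
    have : Fin.append ((fun p : (ℕ × ℕ × ℕ) × (ℕ × ℕ × ℕ) => tripleCode c p.2) ∘
        fun i => (w i, z (Fin.castAdd l i))) (tripleCode c ∘ fun j => z (Fin.natAdd k j)) =
        fun i => tripleCode c (z i) := by
      funext i
      refine Fin.addCases (fun i => ?_) (fun i => ?_) i
      · rw [Fin.append_left]; rfl
      · rw [Fin.append_right]; rfl
    rw [this, Option.isSome_iff_exists]
    exact ⟨v, hn⟩
  · simp
  · simp only [e1]
    exact hdig
  · intro z' hz'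
    simp only [e1]
    rw [tripleLE_iff hc]
    exact hzψj.trans (hN _ (le_max_left _ _) z' (by simpa using hz'))

/-- Primitive recursion on the last interval found, with a search at each step. The order of the
quantifiers matters: a single program serves all `e`, `R` and `ψ`. -/
theorem exists_predictor (k l : ℕ) {c : ℚ} (hc : 0 < c) (j : Fin l) :
    ∃ κ : OracleCode k, ∀ {R : Set ℕ} {ψ : (Fin k → ℝ) → (Fin l → ℝ)}, IsPredictive c R ψ →
      ∀ {e : Code}, SemiDecides e R → ∀ {x : Fin k → ℝ} {φ : Fin k → ℕ → ℕ},
        (∀ i, (decimalBasis c).IsNestedOracle (φ i) (x i)) →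
        ∃ f : ℕ → ℕ,
          (∀ m, f m ∈ κ.eval (fun i => (φ i : ℕ →. ℕ)) (Nat.pair (Encodable.encode e) m)) ∧
          (decimalBasis c).IsNestedOracle f (ψ x j) := by
  classical
  let A := Code × ℕ × Option (ℕ × ℕ × ℕ)
  let W := ℕ × List ((ℕ × ℕ × ℕ) × (ℕ × ℕ × ℕ)) × List (ℕ × ℕ × ℕ)
  have hsearch : Primrec fun q : ℕ × List ℕ × ℕ => decide
      (SearchCondition c l j (decodeD A q.1) q.2.1 (decodeD W q.2.2)) :=
    (primrecPred_searchCondition hc l j).decide.comp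
      ((primrec_decodeD.comp Primrec.fst).pair ((Primrec.fst.comp Primrec.snd).pair
        (primrec_decodeD.comp (Primrec.snd.comp Primrec.snd))))
  obtain ⟨κs, hκs⟩ := OracleCode.exists_search (k := k) (p := fun a V w => decide
      (SearchCondition c l j (decodeD A a) V (decodeD W w))) hsearch.to_comp
  have hnext : Primrec fun w : ℕ => Encodable.encode (some ((decodeD W w).2.2.getD j default)) :=
    Primrec.encode.comp (Primrec.option_some.comp ((Primrec.list_getD default).comp
      (Primrec.snd.comp (Primrec.snd.comp primrec_decodeD)) (Primrec.const (j : ℕ))))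
  obtain ⟨κn, hκn⟩ := OracleCode.exists_eval_eq_of_computable (k := k) hnext.to_comp
  have hout : Primrec fun s : ℕ => tripleCode c ((decodeD (Option (ℕ × ℕ × ℕ)) s).getD default) :=
    (primrec_tripleCode hc).comp (Primrec.option_getD_default.comp primrec_decodeD)
  obtain ⟨κo, hκo⟩ := OracleCode.exists_eval_eq_of_computable (k := k) hout.to_comp
  have hstart : Primrec fun n : ℕ => Nat.pair n.unpair.1 (n.unpair.2 + 1) :=
    Primrec₂.natPair.comp (Primrec.fst.comp Primrec.unpair)
      (Primrec.succ.comp (Primrec.snd.comp Primrec.unpair))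
  obtain ⟨κi, hκi⟩ := OracleCode.exists_eval_eq_of_computable (k := k) hstart.to_comp
  -- The initial value 0 is the code of `none`: the first interval need not lie in an earlier one.
  let κr : OracleCode k := .prec .zero (.comp κn κs)
  refine ⟨.comp κo (.comp κr κi), fun {R ψ} hR {e} he {x φ} hφ => ?_⟩
  set Φ : Fin k → ℕ →. ℕ := fun i => (φ i : ℕ →. ℕ)
  -- The subtype carries the invariant that the current interval contains `ψ x j`, which the next
  -- search needs in order to terminate.
  have hstep : ∀ (m : ℕ) (q : {q : Option (ℕ × ℕ × ℕ) // ∀ z ∈ q, ψ x j ∈ iota (tripleCode c z)}),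
      ∃ z, ψ x j ∈ iota (tripleCode c z) ∧ m < z.2.2 ∧ (∀ z' ∈ q.1, TripleLE c z z') ∧
        Encodable.encode (some z) ∈ OracleCode.eval Φ (.comp κn κs)
          (Nat.pair (Encodable.encode e) (Nat.pair m (Encodable.encode q.1))) := by
    rintro m ⟨q, hq⟩
    have hA : decodeD A (Nat.pair (Encodable.encode e) (Nat.pair m (Encodable.encode q))) =
        (e, m, q) := decodeD_encode (α := A) (e, m, q)
    obtain ⟨t₀, w₀, hw₀⟩ := exists_searchCondition hc hR he hφ j m hq
    obtain ⟨t, w, hw, hwκ⟩ := hκs φ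
      (Nat.pair (Encodable.encode e) (Nat.pair m (Encodable.encode q)))
      ⟨t₀, Encodable.encode w₀, by
        rw [hA, show decodeD W (Encodable.encode w₀) = w₀ from decodeD_encode (α := W) w₀]
        simpa using hw₀⟩
    rw [hA, decide_eq_true_eq] at hw
    refine ⟨(decodeD W w).2.2.getD j default, mem_of_searchCondition hc hR he hφ hw,
      hw.2.2.2.2.1, fun z' hz' => hw.2.2.2.2.2 z' (by simpa using hz'),
      OracleCode.mem_eval_comp.2 ⟨w, hwκ, ?_⟩⟩
    rw [hκn]
    exact Part.mem_some _
  choose next hnext1 hnext2 hnext3 hnext4 using hstep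
  let s : ℕ → {q : Option (ℕ × ℕ × ℕ) // ∀ z ∈ q, ψ x j ∈ iota (tripleCode c z)} := fun m =>
    Nat.rec ⟨none, fun z hz => by simp at hz⟩ (fun m q => ⟨some (next m q), fun z hz => by
      obtain rfl : next m q = z := by simpa using hz
      exact hnext1 m q⟩) m
  have hs : ∀ m, Encodable.encode (s m).1 ∈
      OracleCode.eval Φ κr (Nat.pair (Encodable.encode e) m) := by
    intro m
    induction m with
    | zero =>
      rw [OracleCode.eval_prec_zero]
      exact Part.mem_some _
    | succ m ih =>
      rw [OracleCode.eval_prec_succ, Part.mem_bind_iff]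
      exact ⟨_, ih, hnext4 m (s m)⟩
  -- The output at `m` is the state at `m + 1`, because the state at 0 holds no interval. It has
  -- more than `m` digits, hence at least one.
  refine ⟨fun m => tripleCode c (next m (s m)), fun m => ?_, isNestedOracle_of
    (fun m => (mem_dom_iff hc).2 ⟨_, (Nat.zero_le m).trans_lt (hnext2 m (s m)), rfl⟩)
    (fun m => hnext1 m (s m))
    (fun m => (tripleLE_iff hc _ _).1 (hnext3 (m + 1) (s (m + 1)) _ rfl)) fun a b ha hb => ?_⟩
  · rw [OracleCode.mem_eval_comp]
    refine ⟨Encodable.encode (s (m + 1)).1, OracleCode.mem_eval_comp.2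
      ⟨Nat.pair (Encodable.encode e) (m + 1), ?_, hs (m + 1)⟩, ?_⟩
    · rw [hκi, Nat.unpair_pair]
      exact Part.mem_some _
    · rw [hκo, decodeD_encode]
      exact Part.mem_some _
  · obtain ⟨N, hN⟩ := exists_iota_subset hc ha hb
    exact ⟨N, hN _ _ (hnext2 N (s N)).le (hnext1 N (s N))⟩

/-! ### Enumerability of `R` -/

theorem PrimrecPred.forall_mem {ι α : Type*} [Primcodable α] {P : ι → α → Prop}
    (hP : ∀ i, PrimrecPred (P i)) (L : List ι) : PrimrecPred fun a => ∀ i ∈ L, P i a := by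
  induction L with
  | nil => exact (Primrec.eq.comp (Primrec.const 0) (Primrec.const 0)).of_eq (by simp)
  | cons i L ih => exact ((hP i).and ih).of_eq (by simp)

theorem PrimrecPred.forall_fin {α : Type*} [Primcodable α] {n : ℕ} {P : Fin n → α → Prop}
    (hP : ∀ i, PrimrecPred (P i)) : PrimrecPred fun a => ∀ i, P i a :=
  (PrimrecPred.forall_mem hP (List.finRange n)).of_eq (by simp)

/-- Unbounded search for a witness, with the parameter `a` moved into the program by currying, so
that the program depends computably on `a`. -/
theorem exists_semiDecides {α β : Type*} [Primcodable α] [Inhabited α] [Primcodable β]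
    [Inhabited β] {Q : α → ℕ → β → Prop} (hQ : PrimrecPred fun q : α × ℕ × β => Q q.1 q.2.1 q.2.2) :
    ∃ E : α → Code, Computable E ∧ ∀ a, SemiDecides (E a) {r | ∃ w, Q a r w} := by
  classical
  have hp : Primrec₂ fun (n w : ℕ) => decide (Q (decodeD α n.unpair.1) n.unpair.2 (decodeD β w)) :=
    hQ.decide.comp ((primrec_decodeD.comp (Primrec.fst.comp (Primrec.unpair.comp Primrec.fst))).pair
      ((Primrec.snd.comp (Primrec.unpair.comp Primrec.fst)).pair
        (primrec_decodeD.comp Primrec.snd)))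
  obtain ⟨C, hC⟩ := Code.exists_code.1 (Partrec.nat_iff.1 (Partrec.rfind hp.to_comp.partrec₂))
  refine ⟨fun a => C.curry (primcode a),
    (Code.primrec₂_curry.comp (Primrec.const C) primrec_primcode).to_comp, fun a r => ?_⟩
  rw [Code.eval_curry, hC, Nat.rfind_dom']
  simp only [Nat.unpair_pair, decodeD_primcode, Set.mem_ofPred_eq]
  constructor
  · rintro ⟨n, hn, -⟩
    exact ⟨_, by simpa using hn⟩
  · rintro ⟨w, hw⟩
    exact ⟨primcode w, by simpa [decodeD_primcode] using hw, fun _ => trivial⟩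

theorem exists_code_eval_truncatedOracle {k : ℕ} {c : ℚ} (hc : 0 < c) (κ : OracleCode k) :
    ∃ C : Code, ∀ (z : Fin k → ℕ × ℕ × ℕ) (m : ℕ), C.eval (primcode (z, m)) =
      κ.eval (fun i => truncatedOracle c (tripleMidpoint (z i)) (z i).2.2) m := by
  have h : Partrec₂ fun (z : Fin k → ℕ × ℕ × ℕ) m =>
      κ.eval (fun i => truncatedOracle c (tripleMidpoint (z i)) (z i).2.2) m := by
    refine OracleCode.partrec_eval (φ := fun (z : Fin k → ℕ × ℕ × ℕ) i =>
      truncatedOracle c (tripleMidpoint (z i)) (z i).2.2) (fun i => ?_) κ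
    have hz : Primrec fun p : (Fin k → ℕ × ℕ × ℕ) × ℕ => p.1 i :=
      Primrec.fin_app.comp Primrec.fst (Primrec.const i)
    have hif : Primrec fun p : (Fin k → ℕ × ℕ × ℕ) × ℕ => if p.2 < (p.1 i).2.2 then
        some (tripleCode c (truncatedTriple (p.1 i) p.2)) else none :=
      Primrec.ite (Primrec.nat_lt.comp Primrec.snd (Primrec.snd.comp (Primrec.snd.comp hz)))
        (Primrec.option_some.comp ((primrec_tripleCode hc).comp
          (primrec_truncatedTriple.comp hz Primrec.snd))) (Primrec.const none)
    refine hif.to_comp.ofOption.of_eq fun p => Part.ext fun v => ?_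
    have hmem : v ∈ truncatedOracle c (tripleMidpoint (p.1 i)) (p.1 i).2.2 p.2 ↔
        ∃ _ : p.2 < (p.1 i).2.2, standardOracle c (tripleMidpoint (p.1 i)) p.2 = v := Iff.rfl
    rw [hmem]
    split_ifs with hl
    · rw [standardOracle_tripleMidpoint c _ hl]
      simp [hl, eq_comm]
    · simp [hl]
  obtain ⟨C, hC⟩ := Code.exists_code.1 h
  refine ⟨C, fun z m => ?_⟩
  rw [hC]
  simp [primcode, Part.map_id']

/-- A witness for membership consists of the input triples, the output values, the arguments `m`
producing them and a common step bound; checking it is primitive recursive. -/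
theorem exists_semiDecides_constructedStates {k l : ℕ} {c : ℚ} (hc : 0 < c)
    (κ : Fin l → OracleCode k) : ∃ e, SemiDecides e (constructedStates c κ) := by
  choose C hC using fun j => exists_code_eval_truncatedOracle hc (κ j)
  let B := (Fin k → ℕ × ℕ × ℕ) × (Fin l → ℕ) × (Fin l → ℕ) × ℕ
  have hz : Primrec fun q : Unit × ℕ × B => q.2.2.1 :=
    Primrec.fst.comp (Primrec.snd.comp Primrec.snd)
  have hu : Primrec fun q : Unit × ℕ × B => q.2.2.2.1 :=
    Primrec.fst.comp (Primrec.snd.comp (Primrec.snd.comp Primrec.snd))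
  have hm : Primrec fun q : Unit × ℕ × B => q.2.2.2.2.1 :=
    Primrec.fst.comp (Primrec.snd.comp (Primrec.snd.comp (Primrec.snd.comp Primrec.snd)))
  have hN : Primrec fun q : Unit × ℕ × B => q.2.2.2.2.2 :=
    Primrec.snd.comp (Primrec.snd.comp (Primrec.snd.comp (Primrec.snd.comp Primrec.snd)))
  have hzi := fun i : Fin k => Primrec.fin_app.comp hz (Primrec.const i)
  have hui := fun j : Fin l => Primrec.fin_app.comp hu (Primrec.const j)
  have hmi := fun j : Fin l => Primrec.fin_app.comp hm (Primrec.const j)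
  have hQ : PrimrecPred fun q : Unit × ℕ × B =>
      q.2.1 = listTupleCode ((List.ofFn fun i => tripleCode c (q.2.2.1 i)) ++
        List.ofFn fun j => q.2.2.2.1 j) ∧ (∀ i, 0 < (q.2.2.1 i).2.2) ∧
      ∀ j, Code.evaln q.2.2.2.2.2 (C j) (primcode (q.2.2.1, q.2.2.2.2.1 j)) =
        some (q.2.2.2.1 j) := by
    refine PrimrecPred.and ?_ (PrimrecPred.and (PrimrecPred.forall_fin fun i => ?_)
      (PrimrecPred.forall_fin fun j => ?_))
    · exact Primrec.eq.comp (Primrec.fst.comp Primrec.snd) (primrec_listTupleCode.comp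
        (Primrec.list_append.comp
          (Primrec.list_ofFn fun i => (primrec_tripleCode hc).comp (hzi i))
          (Primrec.list_ofFn hui)))
    · exact Primrec.nat_lt.comp (Primrec.const 0) (Primrec.snd.comp (Primrec.snd.comp (hzi i)))
    · exact Primrec.eq.comp (Code.primrec_evaln.comp ((hN.pair (Primrec.const (C j))).pair
        (primrec_primcode.comp (hz.pair (hmi j))))) (Primrec.option_some.comp (hui j))
  obtain ⟨E, -, hE⟩ := exists_semiDecides (Q := fun (_ : Unit) (r : ℕ) (w : B) =>
    r = listTupleCode ((List.ofFn fun i => tripleCode c (w.1 i)) ++ List.ofFn fun j => w.2.1 j) ∧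
      (∀ i, 0 < (w.1 i).2.2) ∧
      ∀ j, Code.evaln w.2.2.2 (C j) (primcode (w.1, w.2.2.1 j)) = some (w.2.1 j)) hQ
  refine ⟨E (), ?_⟩
  convert hE ()
  ext r
  constructor
  · rintro ⟨u, rfl, p, d, hpd, hj⟩
    simp only [isDecimalCode_iff] at hpd
    choose z hz hd hu hp using hpd
    obtain rfl : d = fun i => (z i).2.2 := funext hd
    obtain rfl : p = fun i => tripleMidpoint (z i) := funext hp
    choose m hm using hj
    simp only [← hC, Code.evaln_complete] at hm
    choose N hN using hm
    refine ⟨(z, fun j => u (Fin.natAdd k j), m, Finset.univ.sup N), ?_, hz, fun j =>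
      Code.evaln_mono (Finset.le_sup (Finset.mem_univ j)) (hN j)⟩
    rw [← List.ofFn_fin_append, listTupleCode_ofFn]
    congr 1
    funext i
    refine Fin.addCases (fun i => ?_) (fun i => ?_) i
    · rw [Fin.append_left, hu]
    · rw [Fin.append_right]
  · rintro ⟨⟨z, u, m, N⟩, rfl, hz, hN⟩
    simp only [] at hz hN ⊢
    rw [← List.ofFn_fin_append, listTupleCode_ofFn]
    refine ⟨_, rfl, fun i => tripleMidpoint (z i), fun i => (z i).2.2, fun i => ?_,
      fun j => ⟨m j, ?_⟩⟩
    · rw [Fin.append_left, isDecimalCode_iff]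
      exact ⟨z i, hz i, rfl, rfl, rfl⟩
    · rw [Fin.append_right, ← hC]
      exact Code.evaln_sound (hN j)

/-! ### Computable physical models -/

/-- A state is a tuple together with the least step bound at which `e` halts on it. This bound is
unique and can be checked, so the states form a recursive set in bijection with `R`. -/
theorem exists_computableModel {n : ℕ} {R : Set ℕ} {e : Code} (he : SemiDecides e R)
    (hR : R ⊆ Set.range (tupleCode n)) :
    ∃ T B f g, IsComputableModel T B ∧ IsModelIso R (Set.range (projection n)) T B f g := by
  classical
  let A := (Fin n → ℕ) × ℕ
  let halts : A → Prop := fun a => (Code.evaln a.2 e (listTupleCode (List.ofFn a.1))).isSome = true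
  have hfirst : ∀ x : Fin n → ℕ, tupleCode n x ∈ R → ∃ N, halts (x, N) ∧ ¬ halts (x, N - 1) := by
    intro x hx
    have hex : ∃ N, halts (x, N) := by
      obtain ⟨v, hv⟩ := Part.dom_iff_mem.1 ((he _).2 hx)
      obtain ⟨N, hN⟩ := Code.evaln_complete.1 hv
      exact ⟨N, by simp only [halts, listTupleCode_ofFn]; exact Option.isSome_iff_exists.2 ⟨v, hN⟩⟩
    refine ⟨Nat.find hex, Nat.find_spec hex, fun h => ?_⟩
    -- Truncated subtraction gives `0 - 1 = 0`, which is harmless because nothing halts with step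
    -- bound 0.
    rcases Nat.eq_zero_or_pos (Nat.find hex) with h0 | h0
    · rw [h0] at h
      simp [halts, Code.evaln] at h
    · exact Nat.find_min hex (by omega) h
  have hmono : ∀ (x : Fin n → ℕ) {N M : ℕ}, N ≤ M → halts (x, N) → halts (x, M) := by
    intro x N M hNM h
    obtain ⟨v, hv⟩ := Option.isSome_iff_exists.1 h
    exact Option.isSome_iff_exists.2 ⟨v, Code.evaln_mono hNM hv⟩
  choose N hN using hfirst
  -- Re-encoding excludes numbers that decode only to the default value. Codes are shifted by one so
  -- that 0 is not a state.
  let T : Set ℕ := {s | (0 < s ∧ primcode (decodeD A (s - 1)) = s - 1) ∧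
    halts (decodeD A (s - 1)) ∧ ¬ halts ((decodeD A (s - 1)).1, (decodeD A (s - 1)).2 - 1)}
  have hdec : Primrec fun s : ℕ => decodeD A (s - 1) :=
    primrec_decodeD.comp (Primrec.nat_sub.comp Primrec.id (Primrec.const 1))
  have hhalts : PrimrecPred halts :=
    Primrec.eq.comp (Primrec.option_isSome.comp (Code.primrec_evaln.comp
      ((Primrec.snd.pair (Primrec.const e)).pair (primrec_listTupleCode.comp
        (Primrec.list_ofFn fun i => Primrec.fin_app.comp Primrec.fst (Primrec.const i))))))
      (Primrec.const true)
  have hT : PrimrecPred fun s => s ∈ T :=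
    ((Primrec.nat_lt.comp (Primrec.const 0) Primrec.id).and
      (Primrec.eq.comp (primrec_primcode.comp hdec) (Primrec.nat_sub.comp Primrec.id
        (Primrec.const 1)))).and
    ((hhalts.comp hdec).and (hhalts.comp ((Primrec.fst.comp hdec).pair
      (Primrec.nat_sub.comp (Primrec.snd.comp hdec) (Primrec.const 1)))).not)
  -- At the spare argument 0 the `i`-th observable takes the value `i`; this keeps the observables
  -- distinct even if they agree on all states.
  let X : ℕ → Fin n → ℕ := fun s => if s = 0 then fun i => i else (decodeD A (s - 1)).1
  have hX : Primrec X := Primrec.ite (Primrec.eq.comp Primrec.id (Primrec.const 0))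
    (Primrec.const _) (Primrec.fst.comp hdec)
  let f : ℕ → ℕ := fun r => if h : tupleCode n (fun i => projection n i r) ∈ R then
    primcode ((fun i => projection n i r, N _ h) : A) + 1 else 0
  have hproj : ∀ r ∈ R, tupleCode n (fun i => projection n i r) = r := by
    intro r hr
    obtain ⟨x, rfl⟩ := hR hr
    simp only [projection_tupleCode]
  have hf : ∀ r (hr : r ∈ R), ∃ M, (halts (fun i => projection n i r, M) ∧
      ¬ halts (fun i => projection n i r, M - 1)) ∧
      f r = primcode ((fun i => projection n i r, M) : A) + 1 := by
    intro r hr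
    have h : tupleCode n (fun i => projection n i r) ∈ R := by rwa [hproj r hr]
    exact ⟨_, hN _ h, dif_pos h⟩
  refine ⟨T, (fun α s => α (tupleCode n (X s))) '' Set.range (projection n), f,
    fun α s => α (tupleCode n (X s)), ⟨hT.computablePred, ?_⟩, ⟨?_, ?_, ?_⟩, ⟨?_, ?_, ?_⟩, ?_⟩
  · rintro _ ⟨_, ⟨i, rfl⟩, rfl⟩
    simp only [projection_tupleCode]
    exact (Primrec.fin_app.comp hX (Primrec.const i)).to_comp
  · intro r hr
    obtain ⟨M, hM, hfr⟩ := hf r hr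
    rw [hfr]
    refine ⟨⟨Nat.succ_pos _, ?_⟩, ?_⟩ <;> rw [Nat.add_sub_cancel, decodeD_primcode]
    exact hM
  · intro r hr r' hr' h
    obtain ⟨M, -, hfr⟩ := hf r hr
    obtain ⟨M', -, hfr'⟩ := hf r' hr'
    rw [hfr, hfr', add_left_inj, primcode_injective.eq_iff, Prod.mk.injEq] at h
    rw [← hproj r hr, ← hproj r' hr', h.1]
  · rintro s ⟨⟨hs0, hs⟩, h1, h2⟩
    obtain ⟨x, M, hxM⟩ : ∃ x M, decodeD A (s - 1) = (x, M) := ⟨_, _, rfl⟩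
    rw [hxM] at hs h1 h2
    have hxR : tupleCode n x ∈ R := by
      obtain ⟨v, hv⟩ := Option.isSome_iff_exists.1 h1
      have := (he _).1 (Part.dom_iff_mem.2 ⟨v, Code.evaln_sound hv⟩)
      rwa [listTupleCode_ofFn] at this
    obtain ⟨M', ⟨hM1, hM2⟩, hfr⟩ := hf _ hxR
    simp only [projection_tupleCode] at hM1 hM2 hfr
    refine ⟨_, hxR, ?_⟩
    have hMM : M' = M := by
      rcases lt_trichotomy M' M with h | h | h
      · exact absurd (hmono x (by omega) hM1) h2
      · exact h
      · exact absurd (hmono x (by omega) h1) hM2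
    rw [hfr, hMM, hs]
    omega
  · exact Set.mapsTo_image _ _
  · rintro _ ⟨i, rfl⟩ _ ⟨i', rfl⟩ h
    have h0 := congrFun h 0
    simp only [projection_tupleCode, X, if_pos] at h0
    rw [Fin.ext h0]
  · exact Set.surjOn_image _ _
  · rintro r hr _ ⟨i, rfl⟩
    obtain ⟨M, -, hfr⟩ := hf r hr
    simp only [projection_tupleCode, hfr, X, if_neg (Nat.succ_ne_zero _), Nat.add_sub_cancel,
      decodeD_primcode]

/-- Since `πᵢ(r) = βᵢ(f r)`, the set `R` is the image of `T` under `s ↦ ⟨β₁(s), …, βₙ(s)⟩`; neither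
`f` nor its inverse has to be computed. -/
theorem exists_semiDecides_of_model (n : ℕ) :
    ∃ E : Code × (Fin n → Code) → Code, Computable E ∧
      ∀ {R : Set ℕ} {T : Set ℕ} {β : Fin n → ℕ → ℕ} {f : ℕ → ℕ} {g : (ℕ → ℕ) → (ℕ → ℕ)} {t : Code}
        {b : Fin n → Code}, R ⊆ Set.range (tupleCode n) →
        IsModelIso R (Set.range (projection n)) T (Set.range β) f g →
        (∀ i, g (projection n i) = β i) → Decides t T →
        (∀ i s, (b i).eval s = Part.some (β i s)) → SemiDecides (E (t, b)) R := by
  let P := Code × (Fin n → Code)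
  let B := ℕ × (Fin n → ℕ) × ℕ
  have ht : Primrec fun q : P × ℕ × B => q.1.1 := Primrec.fst.comp Primrec.fst
  have hb : Primrec fun q : P × ℕ × B => q.1.2 := Primrec.snd.comp Primrec.fst
  have hr : Primrec fun q : P × ℕ × B => q.2.1 := Primrec.fst.comp Primrec.snd
  have hs : Primrec fun q : P × ℕ × B => q.2.2.1 :=
    Primrec.fst.comp (Primrec.snd.comp Primrec.snd)
  have hx : Primrec fun q : P × ℕ × B => q.2.2.2.1 :=
    Primrec.fst.comp (Primrec.snd.comp (Primrec.snd.comp Primrec.snd))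
  have hN : Primrec fun q : P × ℕ × B => q.2.2.2.2 :=
    Primrec.snd.comp (Primrec.snd.comp (Primrec.snd.comp Primrec.snd))
  have hbi := fun i : Fin n => Primrec.fin_app.comp hb (Primrec.const i)
  have hxi := fun i : Fin n => Primrec.fin_app.comp hx (Primrec.const i)
  have hQ : PrimrecPred fun q : P × ℕ × B =>
      q.2.1 = listTupleCode (List.ofFn q.2.2.2.1) ∧
      Code.evaln q.2.2.2.2 q.1.1 q.2.2.1 = some 1 ∧
      ∀ i, Code.evaln q.2.2.2.2 (q.1.2 i) q.2.2.1 = some (q.2.2.2.1 i) := by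
    refine PrimrecPred.and ?_ (PrimrecPred.and ?_ (PrimrecPred.forall_fin fun i => ?_))
    · exact Primrec.eq.comp hr (primrec_listTupleCode.comp (Primrec.list_ofFn hxi))
    · exact Primrec.eq.comp (Code.primrec_evaln.comp ((hN.pair ht).pair hs))
        (Primrec.const (some 1))
    · exact Primrec.eq.comp (Code.primrec_evaln.comp ((hN.pair (hbi i)).pair hs))
        (Primrec.option_some.comp (hxi i))
  obtain ⟨E, hEc, hE⟩ := exists_semiDecides (Q := fun (p : P) (r : ℕ) (w : B) =>
    r = listTupleCode (List.ofFn w.2.1) ∧ Code.evaln w.2.2 p.1 w.1 = some 1 ∧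
      ∀ i, Code.evaln w.2.2 (p.2 i) w.1 = some (w.2.1 i)) hQ
  refine ⟨E, hEc, fun {R T β f g t b} hR ⟨hf, _, hiso⟩ hg hT hβ => ?_⟩
  convert hE (t, b)
  ext r
  have hval : ∀ r ∈ R, tupleCode n (fun i => β i (f r)) = r := by
    intro r hr
    have : (fun i => β i (f r)) = fun i => projection n i r := by
      funext i
      rw [hiso r hr _ ⟨i, rfl⟩, hg]
    rw [this]
    obtain ⟨x, rfl⟩ := hR hr
    simp only [projection_tupleCode]
  constructor
  · intro hr
    have h1 : 1 ∈ t.eval (f r) := by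
      rw [(hT (f r)).1 (hf.mapsTo hr)]
      exact Part.mem_some _
    have h2 : ∀ i, β i (f r) ∈ (b i).eval (f r) := fun i => by
      rw [hβ]
      exact Part.mem_some _
    obtain ⟨N₀, hN₀⟩ := Code.evaln_complete.1 h1
    choose N hN using fun i => Code.evaln_complete.1 (h2 i)
    refine ⟨(f r, fun i => β i (f r), max N₀ (Finset.univ.sup N)), ?_,
      Code.evaln_mono (le_max_left _ _) hN₀, fun i => Code.evaln_mono
        ((Finset.le_sup (f := N) (Finset.mem_univ i)).trans (le_max_right _ _)) (hN i)⟩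
    rw [listTupleCode_ofFn, hval r hr]
  · rintro ⟨⟨s, x, N⟩, rfl, h1, h2⟩
    simp only [] at h1 h2 ⊢
    have hs : s ∈ T := by
      by_contra hs
      have := Code.evaln_sound h1
      rw [(hT s).2 hs] at this
      simp at this
    obtain ⟨r, hr, rfl⟩ := hf.surjOn hs
    have hx : x = fun i => β i (f r) := by
      funext i
      have := Code.evaln_sound (h2 i)
      rw [hβ] at this
      exact Part.mem_some_iff.1 this
    rw [listTupleCode_ofFn, hx, hval r hr]
    exact hr

theorem mainTheorem2 (k l : ℕ) (hl : 0 < l) (c : ℚ) (hc : 0 < c) :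
    -- programs for the functionals are obtained effectively from a program for `R`
    (∃ G : Nat.Partrec.Code → Fin l → OracleCode k,
      (∀ j, Computable fun e => (G e j).toNat) ∧
      ∀ (R : Set ℕ) (H : Set (ℕ → ℕ)) (ψ : (Fin k → ℝ) → (Fin l → ℝ)),
        (R, H) ∈ kreiselRepresentations k l c →
        ((decimalBasis c).power (k + l)).IsBasicRepresentation R (graphSet ψ) →
        (∃ e, SemiDecides e R) ∧
        ∀ e, SemiDecides e R → ComputesOnNestedOracles c ψ (G e)) ∧
    -- and from programs for any computable physical model isomorphic to `(R, H)`
    (∃ P : Nat.Partrec.Code × (Fin (k + l) → Nat.Partrec.Code) → Fin l → OracleCode k,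
      (∀ j, Computable fun q => (P q j).toNat) ∧
      ∀ (R : Set ℕ) (H : Set (ℕ → ℕ)) (ψ : (Fin k → ℝ) → (Fin l → ℝ)),
        (R, H) ∈ kreiselRepresentations k l c →
        ((decimalBasis c).power (k + l)).IsBasicRepresentation R (graphSet ψ) →
        (∃ T B f g, IsComputableModel T B ∧ IsModelIso R H T B f g) ∧
        ∀ (T : Set ℕ) (β : Fin (k + l) → ℕ → ℕ) (f : ℕ → ℕ) (g : (ℕ → ℕ) → (ℕ → ℕ))
          (t : Nat.Partrec.Code) (b : Fin (k + l) → Nat.Partrec.Code),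
          IsModelIso R H T (Set.range β) f g → (∀ i, g (projection (k + l) i) = β i) →
          Decides t T → (∀ i s, (b i).eval s = Part.some (β i s)) →
          ComputesOnNestedOracles c ψ (P (t, b))) := by
  choose κ hκ using fun j : Fin l => exists_predictor k l hc j
  have hG : ∀ j, Computable fun e : Code =>
      ((κ j).curry (Encodable.encode e)).toNat := fun j =>
    ((OracleCode.primrec_toNat_curry (κ j)).comp Primrec.encode).to_comp
  have hcomputes : ∀ {R : Set ℕ} {ψ : (Fin k → ℝ) → (Fin l → ℝ)}, IsPredictive c R ψ →
      ∀ {e : Code}, SemiDecides e R →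
        ComputesOnNestedOracles c ψ fun j => (κ j).curry (Encodable.encode e) := by
    intro R ψ hR e he x φ hφ j
    obtain ⟨f, hf, hfo⟩ := hκ j hR he hφ
    exact ⟨f, fun m => by rw [OracleCode.eval_curry]; exact hf m, hfo⟩
  obtain ⟨E, hEc, hE⟩ := exists_semiDecides_of_model (k + l)
  have hrange : ∀ κ' : Fin l → OracleCode k,
      constructedStates c κ' ⊆ Set.range (tupleCode (k + l)) := by
    rintro κ' _ ⟨u, rfl, -⟩
    exact ⟨u, rfl⟩
  refine ⟨⟨fun e j => (κ j).curry (Encodable.encode e), hG, ?_⟩,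
    fun q j => (κ j).curry (Encodable.encode (E q)), fun j => (hG j).comp hEc, ?_⟩
  · rintro R H ψ ⟨ψ', κ', hκ', hRH⟩ hR
    obtain ⟨rfl, rfl⟩ := Prod.mk.inj hRH
    exact ⟨exists_semiDecides_constructedStates hc κ', fun e he =>
      hcomputes (isPredictive_of_isBasicRepresentation hc hκ' hR) he⟩
  · rintro R H ψ ⟨ψ', κ', hκ', hRH⟩ hR
    obtain ⟨rfl, rfl⟩ := Prod.mk.inj hRH
    -- This `e` serves only to build some model; the prediction itself uses the program that `E`
    -- extracts from the given model.
    obtain ⟨e, he⟩ := exists_semiDecides_constructedStates hc κ'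
    exact ⟨exists_computableModel he (hrange κ'), fun T β f g t b hiso hg hT hβ =>
      hcomputes (isPredictive_of_isBasicRepresentation hc hκ' hR)
        (hE (hrange κ') hiso hg hT hβ)⟩
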